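/- Let $\mathcal G=(V,E)$ be a directed graph on a finite set $V$ of $n$ nodes whose edge set contains all self-loops $i\to i$. Let $\mathrm{An}(i)$ be the set of ancestors of $i$, i.e. of all nodes from which there is a directed path (possibly of length zero) to $i$. The trek graph $\hat{\mathcal G}$ is the bidirected graph on $V$ in which $i$ and $j$ are joined by an edge if and only if $\mathrm{An}(i)\cap\mathrm{An}(j)\neq\emptyset$. A set $S\subseteq V$ separates $I\subseteq V$ from $J\subseteq V$ in $\hat{\mathcal G}$ if every path in $\hat{\mathcal G}$ from a node of $I$ to a node of $J$ contains a node of $S$. The Lyapunov model of $\mathcal G$ is $$\mathcal M_{\mathcal G}=\{\Sigma\in\mathbb R^{V\times V}\text{ symmetric positive definite}: M\Sigma+\Sigma M^{T}+2I_n=0\text{ for some stable }M\in\mathbb R^{E}\},$$ where $M$ is stable if all its complex eigenvalues have negative real part, and $M=(m_{ij})\in\mathbb R^{E}$ means that $m_{ji}=0$ whenever $i\to j$ is not in $E$. For $\Sigma\in\mathcal M_{\mathcal G}$ and $I,J,K\subseteq V$ we say that $I\perp\!\!\!\perp J\mid K$ holds for $\Sigma$ if the subvectors $X_I$ and $X_J$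 of a Gaussian random vector $X\sim\mathcal N(0,\Sigma)$ are conditionally independent given $X_K$. **Theorem 4.1.** The model $\mathcal M_{\mathcal G}$ is Markov-perfect with respect to $\hat{\mathcal G}$: for all pairwise disjoint $I,J,K\subseteq V$, the statement $I\perp\!\!\!\perp J\mid K$ holds for all $\Sigma\in\mathcal M_{\mathcal G}$ if and only if $V\setminus(I\cup J\cup K)$ separates $I$ and $J$ in $\hat{\mathcal G}$. In particular, for distinct $i,j\in V$ and $K\subseteq V\setminus\{i,j\}$, the statement $i\perp\!\!\!\perp j\mid K$ holds for all $\Sigma\in\mathcal M_{\mathcal G}$ if and only if $V\setminus(\{i,j\}\cup K)$ separates $i$ and $j$ in $\hat{\mathcal G}$. -/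

import Mathlib

open MeasureTheory ProbabilityTheory

namespace LyapunovModel

/-- The set of ancestors of `i`: all nodes from which there is a directed path (possibly of
length zero) to `i`. -/
def ancestors {V : Type*} (G : Digraph V) (i : V) : Set V :=
  {a | Relation.ReflTransGen G.Adj a i}

/-- The trek graph of `G`: two distinct nodes are joined by a (bidirected) edge iff they have a
common ancestor in `G`.  The loops at the nodes are left out, as they have no influence on which
node sets are separated. -/
def trekGraph {V : Type*} (G : Digraph V) : SimpleGraph V where
  Adj i j := i ≠ j ∧ (ancestors G i ∩ ancestors G j).Nonempty
  symm := ⟨fun _ _ h => ⟨h.1.symm, Set.inter_comm _ _ ▸ h.2⟩⟩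
  loopless := ⟨fun _ h => h.1 rfl⟩

/-- `S` separates `I` from `J` in `H`: every path from a node of `I` to a node of `J` meets `S`. -/
def Separates {V : Type*} (H : SimpleGraph V) (S I J : Set V) : Prop :=
  ∀ i ∈ I, ∀ j ∈ J, ∀ p : H.Walk i j, p.IsPath → ∃ v ∈ p.support, v ∈ S

/-- A real square matrix is stable if all its complex eigenvalues have negative real part. -/
def IsStable {V : Type*} [Fintype V] [DecidableEq V] (M : Matrix V V ℝ) : Prop :=
  ∀ z ∈ spectrum ℂ (M.map (fun r : ℝ => (r : ℂ))), z.re < 0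

/-- `M` is supported on the edges of `G`: the entry `m_{ji}` vanishes unless `i → j` is an edge. -/
def IsSupportedOn {V : Type*} (G : Digraph V) (M : Matrix V V ℝ) : Prop :=
  ∀ i j, ¬ G.Adj i j → M j i = 0

/-- The graphical continuous Lyapunov model of `G` with diffusion matrix `C`, as a set of
covariance matrices. -/
def lyapunovModel {V : Type*} [Fintype V] [DecidableEq V] (G : Digraph V) (C : Matrix V V ℝ) :
    Set (Matrix V V ℝ) :=
  {S | S.PosDef ∧ ∃ M : Matrix V V ℝ,
    IsStable M ∧ IsSupportedOn G M ∧ M * S + S * M.transpose + C = 0}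

/-- The subvector of coordinates indexed by `I`. -/
def coords {V : Type*} (I : Set V) (x : EuclideanSpace ℝ V) : I → ℝ := fun i => x i

theorem measurable_coords {V : Type*} (I : Set V) : Measurable (coords I) := by
  unfold coords; fun_prop

/-- For a random vector `X` with the centred Gaussian law with covariance matrix `S`, the
subvectors `X_I` and `X_J` are conditionally independent given (the σ-algebra generated by)
`X_K`. -/
def GaussianCI {V : Type*} [Fintype V] [DecidableEq V] (S : Matrix V V ℝ) (I J K : Set V) : Prop :=
  CondIndepFun (MeasurableSpace.comap (coords K) inferInstance) (measurable_coords K).comap_le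
    (coords I) (coords J) (multivariateGaussian 0 S)

/-- A Gaussian model `𝓜` (given by its set of covariance matrices) is Markov-perfect with respect
to the bidirected graph `H`: the conditional independence statements that hold for all
members of the model are exactly those given by separation in `H`. -/
def IsMarkovPerfect {V : Type*} [Fintype V] [DecidableEq V] (𝓜 : Set (Matrix V V ℝ))
    (H : SimpleGraph V) : Prop :=
  ∀ I J K : Set V, Disjoint I J → Disjoint I K → Disjoint J K →
    ((∀ S ∈ 𝓜, GaussianCI S I J K) ↔ Separates H (I ∪ J ∪ K)ᶜ I J)

end LyapunovModel

/-! Soundness. For stable M the operator X ↦ MX + XMᵀ is injective, and it preserves the matrices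
that vanish at pairs without a common ancestor, because ancestors of a parent are ancestors of the
child. Hence every Σ in the model vanishes at such pairs (`apply_eq_zero_of_mem_lyapunovModel`).
Under separation, I ∪ J ∪ K splits into two uncorrelated parts, one containing I and one containing
J, and `gaussianCI_of_block_zero` applies.

Completeness. Without separation, a shortest trek-graph path inside I ∪ J ∪ K is chordless with
interior in K. Its nodes are kept slow and all others are sped up by s⁻². After rescaling, the
Lyapunov equation is regular at s = 0, and small edge weights give control of its solution by a
maximum principle. The normalized covariance tends to a positive definite matrix in which slow and
fast nodes decouple; its slow block is tridiagonal along the path, with positive entries next to the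
diagonal. Conditional independence would give a nonzero vector a of residual coefficients, supported
on K ∪ {j}, with Sa zero on K ∪ {i} (`GaussianCI.exists_residual`). This degeneracy is the vanishing
of a determinant, so it survives in the limit, where tridiagonality forces a = 0
(`eq_zero_of_chordless_path`). -/

/-! ### Conditional expectations and conditional independence for general σ-algebras. -/

section CondIndep

variable {Ω : Type*} {mA mB k₁ k₂ : MeasurableSpace Ω} {mΩ : MeasurableSpace Ω} {μ : Measure Ω}

theorem MeasurableSpace.sup_eq_generateFrom_image2_inter (k₁ k₂ : MeasurableSpace Ω) :
    k₁ ⊔ k₂ = MeasurableSpace.generateFrom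
      (Set.image2 (· ∩ ·) {s | MeasurableSet[k₁] s} {s | MeasurableSet[k₂] s}) := by
  apply le_antisymm
  · refine sup_le (fun s hs => ?_) (fun s hs => ?_)
    · exact MeasurableSpace.measurableSet_generateFrom
        ⟨s, hs, Set.univ, MeasurableSet.univ, Set.inter_univ s⟩
    · exact MeasurableSpace.measurableSet_generateFrom
        ⟨Set.univ, MeasurableSet.univ, s, hs, Set.univ_inter s⟩
  · refine MeasurableSpace.generateFrom_le ?_
    rintro _ ⟨a, ha, b, hb, rfl⟩
    exact MeasurableSet.inter ((le_sup_left : k₁ ≤ k₁ ⊔ k₂) a ha)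
      ((le_sup_right : k₂ ≤ k₁ ⊔ k₂) b hb)

theorem isPiSystem_image2_inter_measurableSet (k₁ k₂ : MeasurableSpace Ω) :
    IsPiSystem (Set.image2 (· ∩ ·) {s | MeasurableSet[k₁] s} {s | MeasurableSet[k₂] s}) := by
  rintro _ ⟨a, ha, b, hb, rfl⟩ _ ⟨c, hc, d, hd, rfl⟩ -
  exact ⟨a ∩ c, MeasurableSet.inter ha hc, b ∩ d, MeasurableSet.inter hb hd,
    Set.inter_inter_inter_comm _ _ _ _⟩

theorem ProbabilityTheory.Indep.indepFun_of_measurable (h : Indep mA mB μ) {f g : Ω → ℝ}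
    (hf : StronglyMeasurable[mA] f) (hg : StronglyMeasurable[mB] g) : IndepFun f g μ :=
  indep_of_indep_of_le_left (indep_of_indep_of_le_right h hg.measurable.comap_le)
    hf.measurable.comap_le

theorem ProbabilityTheory.Indep.setIntegral_inter_mul (h : Indep mA mB μ) (hA : mA ≤ mΩ)
    (hB : mB ≤ mΩ) {f g : Ω → ℝ} (hf : StronglyMeasurable[mA] f) (hg : StronglyMeasurable[mB] g)
    {a b : Set Ω} (ha : MeasurableSet[mA] a) (hb : MeasurableSet[mB] b) :
    ∫ x in a ∩ b, (f * g) x ∂μ = (∫ x in a, f x ∂μ) * ∫ x in b, g x ∂μ := by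
  have hi := h.indepFun_of_measurable (hf.indicator ha) (hg.indicator hb)
  have h' := hi.integral_mul_eq_mul_integral ((hf.indicator ha).mono hA).aestronglyMeasurable
    ((hg.indicator hb).mono hB).aestronglyMeasurable
  rw [integral_indicator (hA _ ha), integral_indicator (hB _ hb)] at h'
  rw [← h', ← integral_indicator ((hA _ ha).inter (hB _ hb))]
  exact integral_congr_ae (Filter.Eventually.of_forall fun x => Set.inter_indicator_mul f g x)

/-- For independent σ-algebras `mA` and `mB`, conditioning a product on sub-σ-algebras of both
splits into two conditional expectations. -/
theorem ProbabilityTheory.Indep.condExp_mul_sup [IsProbabilityMeasure μ] (h : Indep mA mB μ)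
    (hA : mA ≤ mΩ) (hB : mB ≤ mΩ) (h₁ : k₁ ≤ mA) (h₂ : k₂ ≤ mB) {f g : Ω → ℝ}
    (hf : StronglyMeasurable[mA] f) (hg : StronglyMeasurable[mB] g) (hfi : Integrable f μ)
    (hgi : Integrable g μ) :
    μ[f * g | k₁ ⊔ k₂] =ᵐ[μ] μ[f | k₁] * μ[g | k₂] := by
  have hk : k₁ ⊔ k₂ ≤ mΩ := sup_le (h₁.trans hA) (h₂.trans hB)
  have hF : StronglyMeasurable[mA] (μ[f | k₁]) := stronglyMeasurable_condExp.mono h₁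
  have hG : StronglyMeasurable[mB] (μ[g | k₂]) := stronglyMeasurable_condExp.mono h₂
  have hFG : Integrable (μ[f | k₁] * μ[g | k₂]) μ :=
    (h.indepFun_of_measurable hF hG).integrable_mul integrable_condExp integrable_condExp
  have hfg : Integrable (f * g) μ := (h.indepFun_of_measurable hf hg).integrable_mul hfi hgi
  symm
  refine ae_eq_condExp_of_forall_setIntegral_eq hk hfg (fun _ _ _ => hFG.integrableOn) ?_ ?_
  · intro s hs _
    -- The intersections a ∩ b form a π-system generating k₁ ⊔ k₂. On them both integrals factor by
    -- independence; the equality then extends by the π-λ argument.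
    have basic : ∀ a b : Set Ω, MeasurableSet[k₁] a → MeasurableSet[k₂] b →
        ∫ x in a ∩ b, (μ[f | k₁] * μ[g | k₂]) x ∂μ = ∫ x in a ∩ b, (f * g) x ∂μ := by
      intro a b ha hb
      rw [h.setIntegral_inter_mul hA hB hF hG (h₁ _ ha) (h₂ _ hb),
        h.setIntegral_inter_mul hA hB hf hg (h₁ _ ha) (h₂ _ hb),
        setIntegral_condExp (h₁.trans hA) hfi ha, setIntegral_condExp (h₂.trans hB) hgi hb]
    have huniv : ∫ x, (μ[f | k₁] * μ[g | k₂]) x ∂μ = ∫ x, (f * g) x ∂μ := by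
      have := basic Set.univ Set.univ MeasurableSet.univ MeasurableSet.univ
      simpa only [Set.inter_univ, setIntegral_univ] using this
    induction s, hs using MeasurableSpace.induction_on_inter
      (MeasurableSpace.sup_eq_generateFrom_image2_inter k₁ k₂)
      (isPiSystem_image2_inter_measurableSet k₁ k₂) with
    | empty => simp
    | basic t ht =>
      obtain ⟨a, ha, b, hb, rfl⟩ := ht
      exact basic a b ha hb
    | compl t ht ih =>
      have ih := ih (measure_lt_top _ _)
      have e1 := integral_add_compl (hk _ ht) hFG
      have e2 := integral_add_compl (hk _ ht) hfg
      linarith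
    | iUnion t hd ht ih =>
      rw [integral_iUnion (fun i => hk _ (ht i)) hd hFG.integrableOn,
        integral_iUnion (fun i => hk _ (ht i)) hd hfg.integrableOn]
      exact tsum_congr fun i => ih i (measure_lt_top _ _)
  · exact ((stronglyMeasurable_condExp.mono le_sup_left).mul
      (stronglyMeasurable_condExp.mono le_sup_right)).aestronglyMeasurable

/-- By `condExp_mul_sup`, an event of one side ignores the conditioning on the other side (take the
second event to be everything), so the two factors for s ∩ t are the conditional probabilities given
the full join. -/
theorem ProbabilityTheory.Indep.condIndep_sup [StandardBorelSpace Ω] [IsProbabilityMeasure μ]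
    {m₁ m₂ : MeasurableSpace Ω} (h : Indep mA mB μ) (hA : mA ≤ mΩ) (hB : mB ≤ mΩ)
    (h₁ : k₁ ≤ mA) (h₂ : k₂ ≤ mB) (hm₁ : m₁ ≤ mA) (hm₂ : m₂ ≤ mB) (hk : k₁ ⊔ k₂ ≤ mΩ) :
    CondIndep (k₁ ⊔ k₂) m₁ m₂ hk μ := by
  rw [condIndep_iff _ _ _ hk (hm₁.trans hA) (hm₂.trans hB)]
  intro s t hs ht
  have hs' := hm₁ _ hs
  have ht' := hm₂ _ ht
  have sm : ∀ (m : MeasurableSpace Ω) (u : Set Ω), MeasurableSet[m] u →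
      StronglyMeasurable[m] (u.indicator fun _ => (1 : ℝ)) :=
    fun m u hu => stronglyMeasurable_const.indicator hu
  have int : ∀ u : Set Ω, MeasurableSet[mΩ] u → Integrable (u.indicator fun _ => (1 : ℝ)) μ :=
    fun u hu => (integrable_const 1).indicator hu
  have huniv : (Set.univ.indicator fun _ => (1 : ℝ)) = (1 : Ω → ℝ) := by ext; simp
  have key : ∀ u v : Set Ω, MeasurableSet[mA] u → MeasurableSet[mB] v →
      μ⟦u ∩ v | k₁ ⊔ k₂⟧ =ᵐ[μ] μ⟦u | k₁⟧ * μ⟦v | k₂⟧ := by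
    intro u v hu hv
    have := h.condExp_mul_sup hA hB h₁ h₂ (sm _ u hu) (sm _ v hv) (int u (hA _ hu))
      (int v (hB _ hv))
    have e : ((u ∩ v).indicator fun _ => (1 : ℝ)) =
        (u.indicator fun _ => (1 : ℝ)) * (v.indicator fun _ => (1 : ℝ)) := by
      have := Set.inter_indicator_mul (s := u) (t := v) (fun _ : Ω => (1 : ℝ)) (fun _ => 1)
      simp only [mul_one] at this
      exact funext this
    rw [e]
    exact this
  have one₁ : μ⟦(Set.univ : Set Ω) | k₁⟧ = 1 := by
    rw [huniv]; exact condExp_const (h₁.trans hA) (1 : ℝ)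
  have one₂ : μ⟦(Set.univ : Set Ω) | k₂⟧ = 1 := by
    rw [huniv]; exact condExp_const (h₂.trans hB) (1 : ℝ)
  have hS := key s Set.univ hs' MeasurableSet.univ
  have hT := key Set.univ t MeasurableSet.univ ht'
  rw [Set.inter_univ, one₂, mul_one] at hS
  rw [Set.univ_inter, one₁, one_mul] at hT
  exact (key s t hs' ht').trans (hS.symm.mul hT.symm)

end CondIndep

/-- Conditional independence is ordinary independence under almost every conditional measure, and
there the integral of a product factors. -/
theorem ProbabilityTheory.CondIndepFun.condExp_mul {Ω : Type*} {m' mΩ : MeasurableSpace Ω}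
    [StandardBorelSpace Ω] {hm' : m' ≤ mΩ} {μ : Measure Ω} [IsFiniteMeasure μ] {f g : Ω → ℝ}
    (h : CondIndepFun m' hm' f g μ) (hf : Measurable f) (hg : Measurable g)
    (hfi : Integrable f μ) (hgi : Integrable g μ) (hfg : Integrable (f * g) μ) :
    μ[f * g | m'] =ᵐ[μ] μ[f | m'] * μ[g | m'] := by
  have h' := ae_of_ae_trim hm' ((condIndepFun_iff_map_prod_eq_prod_map_map hf hg).1 h)
  filter_upwards [h', condExp_ae_eq_integral_condExpKernel hm' hfg,
    condExp_ae_eq_integral_condExpKernel hm' hfi, condExp_ae_eq_integral_condExpKernel hm' hgi]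
    with ω hω h1 h2 h3
  rw [Pi.mul_apply, h1, h2, h3]
  rw [Kernel.map_apply _ (hf.prodMk hg), Kernel.prod_apply, Kernel.map_apply _ hf,
    Kernel.map_apply _ hg] at hω
  have hi : IndepFun f g (condExpKernel μ m' ω) :=
    (indepFun_iff_map_prod_eq_prod_map_map hf.aemeasurable hg.aemeasurable).2 hω
  exact hi.integral_mul_eq_mul_integral hf.aestronglyMeasurable hg.aestronglyMeasurable

/-- If a linear combination of the variables `X v` has vanishing conditional expectation given `m`,
and each `X v` that occurs is either `m`-measurable or conditionally independent of `Y`, then it is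
orthogonal to `Y`. -/
theorem integral_mul_sum_eq_zero {Ω V : Type*} [Fintype V] {m mΩ : MeasurableSpace Ω}
    [StandardBorelSpace Ω] {μ : Measure Ω} [IsFiniteMeasure μ] (hm : m ≤ mΩ) {Y : Ω → ℝ}
    {X : V → Ω → ℝ} {a : V → ℝ} (hYm : Measurable Y) (hXm : ∀ v, Measurable (X v))
    (hY : MemLp Y 2 μ) (hX : ∀ v, MemLp (X v) 2 μ)
    (h : ∀ v, a v = 0 ∨ StronglyMeasurable[m] (X v) ∨ CondIndepFun m hm Y (X v) μ)
    (h0 : μ[fun x => ∑ v, a v * X v x | m] =ᵐ[μ] 0) :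
    ∫ x, Y x * ∑ v, a v * X v x ∂μ = 0 := by
  have hY1 : Integrable Y μ := hY.integrable one_le_two
  have hX1 : ∀ v, Integrable (X v) μ := fun v => (hX v).integrable one_le_two
  have hYX : ∀ v, Integrable (Y * X v) μ := fun v => hY.integrable_mul (hX v)
  -- Each term satisfies E[Y·aX | m] = E[Y | m]·E[aX | m]; summing, E[Y | m] times the vanishing E[∑
  -- aX | m] comes out.
  have hsplit : ∀ v, μ[Y * a v • X v | m] =ᵐ[μ] μ[Y | m] * μ[a v • X v | m] := by
    intro v
    have key : a v = 0 ∨ μ[Y * X v | m] =ᵐ[μ] μ[Y | m] * μ[X v | m] := by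
      rcases h v with hv | hv | hv
      · exact .inl hv
      · rw [condExp_of_stronglyMeasurable hm hv (hX1 v)]
        exact .inr (condExp_mul_of_stronglyMeasurable_right hv (hYX v) hY1)
      · exact .inr (hv.condExp_mul hYm (hXm v) hY1 (hX1 v) (hYX v))
    rcases key with hv | hv
    · rw [hv, zero_smul, mul_zero, condExp_zero, mul_zero]
    · rw [mul_smul_comm]
      refine (condExp_smul (a v) _ m).trans ?_
      refine Filter.EventuallyEq.trans ?_
        (Filter.EventuallyEq.rfl.mul (condExp_smul (a v) _ m).symm)
      rw [mul_smul_comm]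
      exact hv.const_smul (a v)
  have hR : (fun x => ∑ v, a v * X v x) = ∑ v, a v • X v := by
    ext x; simp
  rw [hR] at h0
  have e1 := condExp_finsetSum (μ := μ) (s := Finset.univ) (f := fun v => Y * a v • X v)
    (fun v _ => by rw [mul_smul_comm]; exact (hYX v).smul (a v)) m
  have e2 := condExp_finsetSum (μ := μ) (s := Finset.univ) (f := fun v => a v • X v)
    (fun v _ => (hX1 v).smul (a v)) m
  have e3 : (fun x => Y x * ∑ v, a v * X v x) = ∑ v, Y * a v • X v := by
    ext x; simp [Finset.mul_sum, mul_left_comm]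
  rw [e3, ← integral_condExp hm]
  refine integral_eq_zero_of_ae ?_
  filter_upwards [e1, e2, h0, Filter.eventually_all.2 hsplit] with x h1 h2 h3 h4
  rw [h1, Finset.sum_apply, Finset.sum_congr rfl fun v _ => h4 v]
  simp only [Pi.mul_apply]
  rw [← Finset.mul_sum, ← Finset.sum_apply, ← h2, h3]
  simp

/-! ### Gaussian vectors: independence, regression residuals and conditional independence. -/

namespace LyapunovModel

open Matrix

variable {V : Type*} [Fintype V]

/-- The linear functional `x ↦ ∑ v, u v * x v` on Euclidean space. -/
noncomputable def linForm (u : V → ℝ) : EuclideanSpace ℝ V →L[ℝ] ℝ :=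
  innerSL ℝ (WithLp.toLp 2 u)

theorem linForm_apply (u : V → ℝ) (x : EuclideanSpace ℝ V) : linForm u x = ∑ v, u v * x v := by
  simp [linForm, PiLp.inner_apply, mul_comm]

variable [DecidableEq V]

theorem linForm_single (i : V) (x : EuclideanSpace ℝ V) : linForm (Pi.single i 1) x = x i := by
  simp [linForm_apply, Pi.single_apply]

theorem covariance_linForm {S : Matrix V V ℝ} (hS : S.PosSemidef) (u v : V → ℝ) :
    cov[fun x => linForm u x, fun x => linForm v x; multivariateGaussian 0 S] = u ⬝ᵥ S *ᵥ v := by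
  have := covarianceBilin_multivariateGaussian (μ := 0) hS (WithLp.toLp 2 u) (WithLp.toLp 2 v)
  rw [covarianceBilin_apply_eq_cov (IsGaussian.memLp_id _ _ (by norm_num))] at this
  exact this

theorem memLp_linForm (S : Matrix V V ℝ) (u : V → ℝ) :
    MemLp (fun x => linForm u x) 2 (multivariateGaussian 0 S) :=
  (IsGaussian.hasGaussianLaw_id.map_fun (linForm u)).memLp_two

theorem integral_linForm (S : Matrix V V ℝ) (u : V → ℝ) :
    ∫ x, linForm u x ∂(multivariateGaussian 0 S) = 0 := by
  rw [ContinuousLinearMap.integral_comp_comm (linForm u)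
    (φ := fun x => x) (memLp_one_iff_integrable.1 (IsGaussian.memLp_id _ 1 (by norm_num)))]
  simp

theorem integral_linForm_mul {S : Matrix V V ℝ} (hS : S.PosSemidef) (u v : V → ℝ) :
    ∫ x, linForm u x * linForm v x ∂(multivariateGaussian 0 S) = u ⬝ᵥ S *ᵥ v := by
  rw [← covariance_linForm hS, covariance_eq_sub (memLp_linForm S u) (memLp_linForm S v),
    integral_linForm S u, zero_mul, sub_zero]
  rfl

theorem indepFun_linForm {S : Matrix V V ℝ} (hS : S.PosSemidef) {ι κ : Type*} [Finite ι]
    [Finite κ] (u : ι → V → ℝ) (v : κ → V → ℝ) (h : ∀ i j, u i ⬝ᵥ S *ᵥ v j = 0) :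
    IndepFun (fun x i => linForm (u i) x) (fun x j => linForm (v j) x)
      (multivariateGaussian 0 S) := by
  have := Fintype.ofFinite ι
  have := Fintype.ofFinite κ
  refine HasGaussianLaw.indepFun_of_covariance_eval
    (X := fun i x => linForm (u i) x) (Y := fun j x => linForm (v j) x) ?_ fun i j => ?_
  · exact (IsGaussian.hasGaussianLaw_id (μ := multivariateGaussian 0 S)).map_fun
      ((ContinuousLinearMap.pi fun i => linForm (u i)).prod
        (ContinuousLinearMap.pi fun j => linForm (v j)))
  · rw [covariance_linForm hS, h]

theorem single_dotProduct_mulVec_single (S : Matrix V V ℝ) (i j : V) :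
    (Pi.single i 1 : V → ℝ) ⬝ᵥ S *ᵥ (Pi.single j 1) = S i j := by
  simp

theorem indepFun_coords {S : Matrix V V ℝ} (hS : S.PosSemidef) {A B : Set V}
    (h : ∀ a ∈ A, ∀ b ∈ B, S a b = 0) :
    IndepFun (coords A) (coords B) (multivariateGaussian 0 S) := by
  have := indepFun_linForm hS (fun i : A => Pi.single (i : V) 1) (fun j : B => Pi.single (j : V) 1)
    fun i j => by rw [single_dotProduct_mulVec_single]; exact h i i.2 j j.2
  simp only [linForm_single] at this
  exact this

omit [Fintype V] [DecidableEq V] in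
theorem comap_coords_le {A : Set V} {m : MeasurableSpace (EuclideanSpace ℝ V)}
    (h : ∀ i ∈ A, Measurable[m] fun x : EuclideanSpace ℝ V => x i) :
    MeasurableSpace.comap (coords A) inferInstance ≤ m :=
  Measurable.comap_le (measurable_pi_iff.2 fun i => h i i.2)

omit [Fintype V] [DecidableEq V] in
theorem measurable_comap_coords {A : Set V} {i : V} (h : i ∈ A) :
    Measurable[MeasurableSpace.comap (coords A) inferInstance]
      fun x : EuclideanSpace ℝ V => x i :=
  (measurable_pi_apply (⟨i, h⟩ : A)).comp (comap_measurable (coords A))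

omit [Fintype V] [DecidableEq V] in
theorem comap_coords_mono {A B : Set V} (h : A ⊆ B) :
    MeasurableSpace.comap (coords A) inferInstance ≤
      MeasurableSpace.comap (coords B) inferInstance :=
  comap_coords_le fun _ hi => measurable_comap_coords (h hi)

omit [Fintype V] [DecidableEq V] in
theorem comap_coords_union (A B : Set V) :
    (MeasurableSpace.comap (coords (A ∪ B)) inferInstance : MeasurableSpace (EuclideanSpace ℝ V)) =
      MeasurableSpace.comap (coords A) inferInstance ⊔
        MeasurableSpace.comap (coords B) inferInstance := by
  apply le_antisymm
  · refine comap_coords_le fun i hi => ?_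
    rcases hi with hi | hi
    · exact (measurable_comap_coords hi).mono le_sup_left le_rfl
    · exact (measurable_comap_coords hi).mono le_sup_right le_rfl
  · exact sup_le (comap_coords_mono Set.subset_union_left)
      (comap_coords_mono Set.subset_union_right)

/-- If `I ∪ J ∪ K` is covered by two sets of coordinates that are uncorrelated, one containing `I`
and one containing `J`, then `X_I` and `X_J` are conditionally independent given `X_K`. -/
theorem gaussianCI_of_block_zero {S : Matrix V V ℝ} (hS : S.PosSemidef) {I J K A B : Set V}
    (hI : I ⊆ A) (hJ : J ⊆ B) (hK : K ⊆ A ∪ B) (h : ∀ a ∈ A, ∀ b ∈ B, S a b = 0) :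
    GaussianCI S I J K := by
  -- The σ-algebra is generalized because the proof `hm'` depends on it, which blocks rewriting
  -- σ(X_K) as a join.
  have key : ∀ (m' : MeasurableSpace (EuclideanSpace ℝ V)) (hm' : m' ≤ WithLp.measurableSpace 2 _),
      m' = MeasurableSpace.comap (coords (K ∩ A)) inferInstance ⊔
        MeasurableSpace.comap (coords (K ∩ B)) inferInstance →
      CondIndepFun m' hm' (coords I) (coords J) (multivariateGaussian 0 S) := by
    rintro _ hm' rfl
    rw [condIndepFun_iff_condIndep]
    exact ProbabilityTheory.Indep.condIndep_sup (indepFun_coords hS h)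
      (measurable_coords A).comap_le (measurable_coords B).comap_le
      (comap_coords_mono Set.inter_subset_right) (comap_coords_mono Set.inter_subset_right)
      (comap_coords_mono hI) (comap_coords_mono hJ) hm'
  refine key _ _ ?_
  rw [← comap_coords_union, ← Set.inter_union_distrib_left, Set.inter_eq_left.2 hK]

/-- Solving for a linear regression: there are coefficients `a` supported on `K ∪ {j}` with
`a j = 1` such that the residual `∑ v, a v * X v` is uncorrelated with `X_K`. -/
theorem exists_residual {S : Matrix V V ℝ} (hS : S.PosDef) {j : V} {K : Set V} (hj : j ∉ K) :
    ∃ a : V → ℝ, a j = 1 ∧ (∀ x, x ∉ K → x ≠ j → a x = 0) ∧ ∀ x ∈ K, (S *ᵥ a) x = 0 := by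
  classical
  let B : Matrix V V ℝ := Matrix.of fun x y =>
    if x ∈ K then S x y else (1 : Matrix V V ℝ) x y
  have hB : ∀ a x, (B *ᵥ a) x = if x ∈ K then (S *ᵥ a) x else a x := by
    intro a x
    have hx : B x = if x ∈ K then S x else (1 : Matrix V V ℝ) x := by
      ext y; by_cases hx : x ∈ K <;> simp [B, hx]
    by_cases h : x ∈ K
    · simp [mulVec, hx, h]
    · simp only [mulVec, hx, h, if_false]
      exact congrFun (one_mulVec a) x
  -- A kernel vector vanishes off K while its image under S vanishes on K, so its quadratic form is
  -- zero.
  have hdet : B.det ≠ 0 := by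
    intro h0
    obtain ⟨a, ha, h⟩ := Matrix.exists_mulVec_eq_zero_iff.2 h0
    have h1 : ∀ x, a x * (S *ᵥ a) x = 0 := fun x => by
      have := congrFun h x
      rw [hB] at this
      by_cases hx : x ∈ K
      · simp only [hx, if_true] at this; simp [this]
      · simp only [hx, if_false] at this; simp [this]
    have := hS.dotProduct_mulVec_pos ha
    simp [dotProduct, h1] at this
  obtain ⟨a, ha⟩ : ∃ a, B *ᵥ a = Pi.single j 1 := by
    refine ⟨B⁻¹ *ᵥ Pi.single j 1, ?_⟩
    rw [mulVec_mulVec, mul_nonsing_inv _ (isUnit_iff_ne_zero.2 hdet), one_mulVec]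
  refine ⟨a, ?_, fun x hx hxj => ?_, fun x hx => ?_⟩
  · have := congrFun ha j; rw [hB] at this; simpa [hj] using this
  · have := congrFun ha x; rw [hB] at this; simpa [hx, hxj] using this
  · have := congrFun ha x; rw [hB] at this
    have hxj : x ≠ j := fun h => hj (h ▸ hx)
    simpa [hx, hxj] using this

/-- The residual of regressing X_j on X_K is uncorrelated with X_K, hence independent of it, and so
has conditional mean zero. Conditional independence then makes it orthogonal to X_i. This turns the
probabilistic statement into linear algebra. -/
theorem GaussianCI.exists_residual {S : Matrix V V ℝ} (hS : S.PosDef) {I J K : Set V}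
    (h : GaussianCI S I J K) {i j : V} (hi : i ∈ I) (hj : j ∈ J) (hjK : j ∉ K) :
    ∃ a : V → ℝ, a j = 1 ∧ (∀ x, x ∉ K → x ≠ j → a x = 0) ∧ (∀ x ∈ K, (S *ᵥ a) x = 0) ∧
      (S *ᵥ a) i = 0 := by
  obtain ⟨a, ha1, ha2, ha3⟩ := LyapunovModel.exists_residual hS hjK
  refine ⟨a, ha1, ha2, ha3, ?_⟩
  have hmem : ∀ v : V,
      MemLp (fun x : EuclideanSpace ℝ V => x v) 2 (multivariateGaussian 0 S) := fun v => by
    simpa only [linForm_single] using memLp_linForm S (Pi.single v 1)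
  have hind : IndepFun (fun x => linForm a x) (coords K) (multivariateGaussian 0 S) := by
    have := indepFun_linForm hS.posSemidef (fun _ : Unit => a)
      (fun k : K => Pi.single (k : V) 1) fun _ k => by
        have hsymm : S.transpose = S := hS.isHermitian
        rw [dotProduct_mulVec, ← mulVec_transpose, hsymm]
        simpa using ha3 k k.2
    simp only [linForm_single] at this
    exact this.comp (measurable_pi_apply ()) measurable_id
  have hR := condExp_indep_eq
    (measurable_iff_comap_le.1 (linForm a).continuous.measurable)
    (measurable_coords K).comap_le
    (f := fun x => linForm a x) (comap_measurable _).stronglyMeasurable hind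
  rw [integral_linForm] at hR
  have hsum : ∀ x, linForm a x = ∑ v, a v * x v := linForm_apply a
  have hz := integral_mul_sum_eq_zero (μ := multivariateGaussian 0 S)
    (measurable_coords K).comap_le (Y := fun x => x i) (X := fun v x => x v) (a := a)
    (by fun_prop) (fun v => by fun_prop) (hmem i) hmem (fun v => ?_) (by simp only [hsum] at hR; exact hR)
  · have := integral_linForm_mul hS.posSemidef (Pi.single i 1) a
    simp only [linForm_single, hsum, single_one_dotProduct] at this
    rw [← this]
    exact hz
  · by_cases hv : v ∈ K
    · exact .inr (.inl (measurable_comap_coords hv).stronglyMeasurable)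
    by_cases hvj : v = j
    · subst hvj
      exact .inr (.inr (CondIndepFun.comp h (measurable_pi_apply (⟨i, hi⟩ : I))
        (measurable_pi_apply (⟨v, hj⟩ : J))))
    · exact .inl (ha2 v hv hvj)

end LyapunovModel

/-! ### Stability and the Lyapunov equation; vanishing covariances. -/

namespace LyapunovModel

open Matrix

variable {V : Type*} [Fintype V] [DecidableEq V]

theorem mem_spectrum_transpose {A : Matrix V V ℂ} {z : ℂ} :
    z ∈ spectrum ℂ Aᵀ ↔ z ∈ spectrum ℂ A := by
  rw [Matrix.mem_spectrum_iff_isRoot_charpoly, Matrix.mem_spectrum_iff_isRoot_charpoly,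
    Matrix.charpoly_transpose]

theorem exists_mulVec_eq_smul_of_mem_spectrum {A : Matrix V V ℂ} {z : ℂ}
    (hz : z ∈ spectrum ℂ A) : ∃ w ≠ 0, A *ᵥ w = z • w := by
  rw [spectrum.mem_iff, Matrix.isUnit_iff_isUnit_det, isUnit_iff_ne_zero, not_not] at hz
  obtain ⟨w, hw, h⟩ := Matrix.exists_mulVec_eq_zero_iff.2 hz
  refine ⟨w, hw, ?_⟩
  rw [sub_mulVec, Algebra.algebraMap_eq_smul_one, smul_mulVec, one_mulVec, sub_eq_zero] at h
  exact h.symm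

/-- Uniqueness for the Sylvester equation: intertwiners of matrices with disjoint spectra vanish. -/
theorem eq_zero_of_mul_eq_mul_of_disjoint_spectrum {A B X : Matrix V V ℂ} (h : A * X = X * B)
    (hd : ∀ z ∈ spectrum ℂ A, z ∉ spectrum ℂ B) : X = 0 := by
  cases isEmpty_or_nonempty V
  · exact Subsingleton.elim _ _
  have hpow : ∀ n : ℕ, A ^ n * X = X * B ^ n := by
    intro n
    induction n with
    | zero => simp
    | succ n ih => rw [pow_succ, mul_assoc, h, ← mul_assoc, ih, mul_assoc, ← pow_succ]
  have hpoly : ∀ p : Polynomial ℂ, Polynomial.aeval A p * X = X * Polynomial.aeval B p := by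
    intro p
    induction p using Polynomial.induction_on' with
    | add p q hp hq => simp only [map_add, add_mul, mul_add, hp, hq]
    | monomial n c =>
      simp only [Polynomial.aeval_monomial, Algebra.algebraMap_eq_smul_one, smul_mul_assoc,
        one_mul, mul_smul_comm, hpow n]
  -- By Cayley–Hamilton χ_B(A) X = 0, and χ_B(A) is invertible because no eigenvalue of A is a root
  -- of χ_B.
  have h0 := hpoly B.charpoly
  rw [Matrix.aeval_self_charpoly, mul_zero] at h0
  have hu : IsUnit (Polynomial.aeval A B.charpoly) := by
    by_contra hu
    have h1 : (0 : ℂ) ∈ spectrum ℂ (Polynomial.aeval A B.charpoly) :=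
      (spectrum.zero_mem_iff ℂ).2 hu
    rw [spectrum.map_polynomial_aeval_of_nonempty _ _
      (spectrum.nonempty_of_isAlgClosed_of_finiteDimensional ℂ A)] at h1
    obtain ⟨z, hz, hz0⟩ := h1
    exact hd z hz (Matrix.mem_spectrum_iff_isRoot_charpoly.2 hz0)
  exact (hu.mul_right_eq_zero).1 h0

/-- X intertwines M and -Mᵀ, whose spectra lie in opposite open half-planes. -/
theorem IsStable.eq_zero_of_lyapunov {M X : Matrix V V ℝ} (hM : IsStable M)
    (h : M * X + X * Mᵀ = 0) : X = 0 := by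
  have hc : (X.map (fun r : ℝ => (r : ℂ))) = 0 := by
    refine eq_zero_of_mul_eq_mul_of_disjoint_spectrum (A := M.map (fun r : ℝ => (r : ℂ)))
      (B := -(M.map (fun r : ℝ => (r : ℂ)))ᵀ) ?_ ?_
    · rw [mul_neg, eq_neg_iff_add_eq_zero]
      ext x y
      have := congrArg (fun r : ℝ => (r : ℂ)) (congrFun (congrFun h x) y)
      simpa [Matrix.mul_apply] using this
    · intro z hz hz'
      rw [← spectrum.neg_eq, Set.mem_neg, mem_spectrum_transpose] at hz'
      have h1 := hM z hz
      have h2 := hM (-z) hz'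
      rw [Complex.neg_re] at h2
      linarith
  ext x y
  have := congrFun (congrFun hc x) y
  simpa using this

/-- Lyapunov's criterion. -/
theorem isStable_of_lyapunov {M S : Matrix V V ℝ} (hS : S.PosDef)
    (h : M * S + S * Mᵀ + (2 : ℝ) • (1 : Matrix V V ℝ) = 0) : IsStable M := by
  intro z hz
  -- With w an eigenvector of Mᵀ, the Lyapunov equation gives Re z · w*Sw = -w*w. The computation is
  -- carried out on the real and imaginary parts of w.
  obtain ⟨w, hw0, hw⟩ := exists_mulVec_eq_smul_of_mem_spectrum (mem_spectrum_transpose.2 hz)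
  set u : V → ℝ := fun x => (w x).re with hu
  set v : V → ℝ := fun x => (w x).im with hv
  have hMu : Mᵀ *ᵥ u = z.re • u - z.im • v := by
    ext x
    have := congrArg Complex.re (congrFun hw x)
    simpa [mulVec, dotProduct, hu, hv] using this
  have hMv : Mᵀ *ᵥ v = z.im • u + z.re • v := by
    ext x
    have := congrArg Complex.im (congrFun hw x)
    simp [mulVec, dotProduct] at this
    simp [mulVec, dotProduct, hu, hv, this]
    ring
  have hsymm : Sᵀ = S := hS.isHermitian
  have hswap : ∀ a b : V → ℝ, a ⬝ᵥ S *ᵥ b = b ⬝ᵥ S *ᵥ a := fun a b => by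
    rw [dotProduct_mulVec, ← mulVec_transpose, hsymm, dotProduct_comm]
  have hquad : ∀ a : V → ℝ, a ⬝ᵥ S *ᵥ (Mᵀ *ᵥ a) = -(a ⬝ᵥ a) := by
    intro a
    have h1 := congrArg (fun N => a ⬝ᵥ N *ᵥ a) h
    simp only [add_mulVec, dotProduct_add, smul_mulVec, one_mulVec, dotProduct_smul,
      zero_mulVec, dotProduct_zero, ← mulVec_mulVec] at h1
    have h2 : a ⬝ᵥ M *ᵥ (S *ᵥ a) = a ⬝ᵥ S *ᵥ (Mᵀ *ᵥ a) := by
      rw [dotProduct_mulVec, ← mulVec_transpose, hswap]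
    rw [h2, smul_eq_mul] at h1
    linarith
  have e1 := hquad u
  have e2 := hquad v
  rw [hMu, mulVec_sub, mulVec_smul, mulVec_smul, dotProduct_sub, dotProduct_smul,
    dotProduct_smul] at e1
  rw [hMv, mulVec_add, mulVec_smul, mulVec_smul, dotProduct_add, dotProduct_smul,
    dotProduct_smul, hswap v u] at e2
  simp only [smul_eq_mul] at e1 e2
  have hsum : z.re * (u ⬝ᵥ S *ᵥ u + v ⬝ᵥ S *ᵥ v) = -(u ⬝ᵥ u + v ⬝ᵥ v) := by linarith
  have hnn : ∀ a : V → ℝ, 0 ≤ a ⬝ᵥ S *ᵥ a := fun a => by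
    simpa using hS.posSemidef.dotProduct_mulVec_nonneg a
  have hpos : 0 < u ⬝ᵥ u + v ⬝ᵥ v := by
    have hsq : ∀ a : V → ℝ, 0 ≤ a ⬝ᵥ a := fun a =>
      Finset.sum_nonneg fun x _ => mul_self_nonneg (a x)
    rcases (add_nonneg (hsq u) (hsq v)).lt_or_eq with h0 | h0
    · exact h0
    · exfalso
      have hu0 : u ⬝ᵥ u = 0 := by linarith [hsq u, hsq v]
      have hv0 : v ⬝ᵥ v = 0 := by linarith [hsq u, hsq v]
      rw [dotProduct_self_eq_zero] at hu0 hv0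
      apply hw0
      ext x
      exact Complex.ext (congrFun hu0 x) (congrFun hv0 x)
  by_contra hre
  rw [not_lt] at hre
  have := mul_nonneg hre (add_nonneg (hnn u) (hnn v))
  linarith

omit [Fintype V] [DecidableEq V] in
theorem ancestors_subset_of_adj {G : Digraph V} {x y : V} (h : G.Adj x y) :
    ancestors G x ⊆ ancestors G y :=
  fun _ ha => Relation.ReflTransGen.tail ha h

omit [Fintype V] [DecidableEq V] in
theorem self_mem_ancestors (G : Digraph V) (x : V) : x ∈ ancestors G x :=
  Relation.ReflTransGen.refl

/-- Covariances in the model vanish between nodes without a common ancestor. -/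
theorem apply_eq_zero_of_mem_lyapunovModel {G : Digraph V} {S : Matrix V V ℝ}
    (hS : S ∈ lyapunovModel G ((2 : ℝ) • (1 : Matrix V V ℝ))) {x y : V}
    (hxy : ¬ (ancestors G x ∩ ancestors G y).Nonempty) : S x y = 0 := by
  obtain ⟨-, M, hM, hMG, hL⟩ := hS
  let W : Submodule ℝ (Matrix V V ℝ) :=
    { carrier := {X | ∀ x y, ¬ (ancestors G x ∩ ancestors G y).Nonempty → X x y = 0}
      add_mem' := fun {X Y} hX hY x y h => by simp [hX x y h, hY x y h]
      zero_mem' := fun _ _ _ => rfl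
      smul_mem' := fun c X hX x y h => by simp [hX x y h] }
  let L : Matrix V V ℝ →ₗ[ℝ] Matrix V V ℝ :=
    LinearMap.mulLeft ℝ M + LinearMap.mulRight ℝ Mᵀ
  have hLapp : ∀ X, L X = M * X + X * Mᵀ := fun X => rfl
  have hLW : ∀ X ∈ W, L X ∈ W := by
    intro X hX x y h
    rw [hLapp, Matrix.add_apply, Matrix.mul_apply, Matrix.mul_apply,
      Finset.sum_eq_zero, Finset.sum_eq_zero, add_zero]
    · intro k _
      by_cases hk : G.Adj k y
      · rw [hX x k, zero_mul]
        exact fun hne => h (hne.mono (Set.inter_subset_inter_right _ (ancestors_subset_of_adj hk)))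
      · rw [transpose_apply, hMG k y hk, mul_zero]
    · intro k _
      by_cases hk : G.Adj k x
      · rw [hX k y, mul_zero]
        exact fun hne => h (hne.mono (Set.inter_subset_inter_left _ (ancestors_subset_of_adj hk)))
      · rw [hMG k x hk, zero_mul]
  have hinj : Function.Injective L := by
    rw [injective_iff_map_eq_zero]
    intro X hX
    exact hM.eq_zero_of_lyapunov hX
  -- An injective endomorphism of the finite-dimensional space W is onto, so the equation already
  -- has a solution in W, and uniqueness identifies it with S.
  have hsurj : Function.Surjective (L.restrict hLW) := by
    refine LinearMap.injective_iff_surjective.1 fun X Y hXY => ?_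
    exact Subtype.ext (hinj (congrArg Subtype.val hXY))
  have hW : -((2 : ℝ) • (1 : Matrix V V ℝ)) ∈ W := by
    intro x y h
    have hne : x ≠ y := by
      rintro rfl
      exact h ⟨x, self_mem_ancestors G x, self_mem_ancestors G x⟩
    simp [hne]
  obtain ⟨⟨X, hXW⟩, hX⟩ := hsurj ⟨_, hW⟩
  have hX' : L X = -((2 : ℝ) • (1 : Matrix V V ℝ)) := congrArg Subtype.val hX
  have hSX : S = X := hinj (hX'.symm ▸ eq_neg_of_add_eq_zero_left hL)
  rw [hSX]
  exact hXW x y hxy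

end LyapunovModel

/-! ### The rescaled Lyapunov equation: maximum principle, bounds and positivity. -/

namespace LyapunovModel

open Matrix

variable {V : Type*} [Fintype V]

/-- A symmetric matrix with small off-diagonal entries is positive definite. -/
theorem posDef_of_offDiag_le [DecidableEq V] {S : Matrix V V ℝ} {c δ : ℝ} (hsymm : ∀ x y, S x y = S y x)
    (hdiag : ∀ x, c ≤ S x x) (hδ : 0 ≤ δ) (hoff : ∀ x y, x ≠ y → |S x y| ≤ δ)
    (hc : Fintype.card V * δ < c) : S.PosDef := by
  refine Matrix.PosDef.of_dotProduct_mulVec_pos (by ext x y; simp [hsymm y x]) fun v hv => ?_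
  -- The off-diagonal terms are bounded by 2|ab| ≤ a² + b²; summing over all pairs leaves (c -
  -- nδ)·|v|².
  have hterm : ∀ x y, (if x = y then c * v x ^ 2 else 0) - δ * ((v x ^ 2 + v y ^ 2) / 2) ≤
      v x * (S x y * v y) := by
    intro x y
    split_ifs with h
    · subst h
      nlinarith [hdiag x, sq_nonneg (v x), mul_nonneg hδ (sq_nonneg (v x))]
    · have h1 : |v x * (S x y * v y)| ≤ δ * ((v x ^ 2 + v y ^ 2) / 2) := by
        have e : |v x * (S x y * v y)| = |S x y| * (|v x| * |v y|) := by
          rw [abs_mul, abs_mul]; ring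
        rw [e]
        refine mul_le_mul (hoff x y h) ?_ (by positivity) hδ
        nlinarith [sq_nonneg (|v x| - |v y|), sq_abs (v x), sq_abs (v y)]
      linarith [neg_abs_le (v x * (S x y * v y))]
  have hsum : ∑ x, ∑ y, ((if x = y then c * v x ^ 2 else 0) - δ * ((v x ^ 2 + v y ^ 2) / 2)) =
      (c - Fintype.card V * δ) * ∑ x, v x ^ 2 := by
    simp only [Finset.sum_sub_distrib, Finset.sum_ite_eq, Finset.mem_univ, if_true,
      ← Finset.mul_sum, ← Finset.sum_div, Finset.sum_add_distrib, Finset.sum_const,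
      Finset.card_univ, nsmul_eq_mul]
    ring
  have hpos : 0 < ∑ x, v x ^ 2 := by
    obtain ⟨x, hx⟩ := Function.ne_iff.1 hv
    exact Finset.sum_pos' (fun _ _ => sq_nonneg _) ⟨x, Finset.mem_univ x, by
      have : v x ≠ 0 := hx
      positivity⟩
  have hle : ∑ x, ∑ y, ((if x = y then c * v x ^ 2 else 0) - δ * ((v x ^ 2 + v y ^ 2) / 2)) ≤
      ∑ x, ∑ y, v x * (S x y * v y) :=
    Finset.sum_le_sum fun x _ => Finset.sum_le_sum fun y _ => hterm x y
  have he : star v ⬝ᵥ S *ᵥ v = ∑ x, ∑ y, v x * (S x y * v y) := by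
    simp [dotProduct, mulVec, Finset.mul_sum]
  rw [he]
  rw [hsum] at hle
  exact lt_of_lt_of_le (mul_pos (by linarith) hpos) hle

/-- The common weight of the edges in the drift matrices constructed below. -/
noncomputable def eps (V : Type*) [Fintype V] : ℝ := 1 / (16 * (Fintype.card V + 1) ^ 2)

theorem eps_pos : 0 < eps V := by unfold eps; positivity

theorem sixteen_mul_eps : 16 * (Fintype.card V + 1 : ℝ) ^ 2 * eps V = 1 := by
  unfold eps; field_simp

theorem card_mul_eps_le : (Fintype.card V : ℝ) * eps V ≤ 1 / 16 := by
  have h := sixteen_mul_eps (V := V)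
  have h1 := eps_pos (V := V)
  have h2 : (0 : ℝ) ≤ Fintype.card V := Nat.cast_nonneg _
  nlinarith [mul_nonneg h2 h1.le, mul_nonneg (mul_nonneg h2 h2) h1.le]

/-- The square in `eps` serves this bound: off-diagonal entries of size 8n·`eps`, multiplied by n,
must stay below the diagonal bound 3/4. The `+ 1` keeps `eps` positive when V is empty. -/
theorem card_mul_card_mul_eps_le :
    (Fintype.card V : ℝ) * (Fintype.card V * eps V) ≤ 1 / 16 := by
  have h := sixteen_mul_eps (V := V)
  have h1 := eps_pos (V := V)
  have h2 : (0 : ℝ) ≤ Fintype.card V := Nat.cast_nonneg _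
  nlinarith [mul_nonneg h2 h1.le, mul_nonneg (mul_nonneg h2 h2) h1.le]

open Classical in
/-- The weight `eps V` for the proper edges `z → x`. -/
noncomputable def edgeWeight (G : Digraph V) (x z : V) : ℝ :=
  if G.Adj z x ∧ z ≠ x then eps V else 0

theorem edgeWeight_nonneg (G : Digraph V) (x z : V) : 0 ≤ edgeWeight G x z := by
  unfold edgeWeight; split_ifs; exacts [eps_pos.le, le_rfl]

theorem edgeWeight_le (G : Digraph V) (x z : V) : edgeWeight G x z ≤ eps V := by
  unfold edgeWeight; split_ifs; exacts [le_rfl, eps_pos.le]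

theorem adj_of_edgeWeight_ne_zero {G : Digraph V} {x z : V} (h : edgeWeight G x z ≠ 0) :
    G.Adj z x := by
  by_contra h'
  exact h (if_neg fun h'' => h' h''.1)

omit [Fintype V] in
open Classical in
/-- The factor by which the covariance of the nodes `x` and `y` is damped along the leg at `x`,
when the nodes outside the set `A` of slow nodes are sped up by the factor `s⁻²`. -/
noncomputable def damping (A : Set V) (s : ℝ) (x y : V) : ℝ :=
  if x ∈ A ∧ y ∉ A then s ^ 2 else 1

section damping

variable {A : Set V} {s : ℝ}

omit [Fintype V] in
theorem damping_nonneg (x y : V) : 0 ≤ damping A s x y := by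
  unfold damping; split_ifs <;> positivity

omit [Fintype V] in
theorem damping_le_one (h : s ^ 2 ≤ 1) (x y : V) : damping A s x y ≤ 1 := by
  unfold damping; split_ifs; exacts [h, le_rfl]

omit [Fintype V] in
theorem one_le_damping_add (x y : V) : 1 ≤ damping A s x y + damping A s y x := by
  have := sq_nonneg s
  unfold damping; split_ifs with h1 h2 <;> first | linarith | exact absurd h2.1 h1.2

omit [Fintype V] in
theorem damping_self (x : V) : damping A s x x = 1 :=
  if_neg fun h => h.2 h.1

omit [Fintype V] in
theorem abs_damping_sub_le (x y : V) : |damping A 0 x y - damping A s x y| ≤ s ^ 2 := by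
  have := sq_nonneg s
  unfold damping; split_ifs <;> simp [this]

omit [Fintype V] in
theorem damping_eq_one {x y : V} (h : x ∉ A ∨ y ∈ A) : damping A s x y = 1 :=
  if_neg fun h' => h.elim (fun hx => hx h'.1) fun hy => h'.2 hy

end damping

/-- The contribution of the edges into `x` to the equation for the covariance of `x` and `y`. -/
noncomputable def inflow (G : Digraph V) (A : Set V) (s : ℝ) (Z : Matrix V V ℝ) (x y : V) : ℝ :=
  ∑ z, edgeWeight G x z * (damping A s z y * Z z y)

theorem abs_inflow_le {G : Digraph V} {A : Set V} {s : ℝ} (hs : s ^ 2 ≤ 1) {Z : Matrix V V ℝ}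
    {m : ℝ} {x y : V} (hm : 0 ≤ m) (h : ∀ z, edgeWeight G x z ≠ 0 → |Z z y| ≤ m) :
    |inflow G A s Z x y| ≤ Fintype.card V * eps V * m := by
  have : ∀ z ∈ Finset.univ, |edgeWeight G x z * (damping A s z y * Z z y)| ≤ eps V * m := by
    intro z _
    by_cases hz : edgeWeight G x z = 0
    · rw [hz, zero_mul, abs_zero]; exact mul_nonneg eps_pos.le hm
    · rw [abs_mul, abs_mul, abs_of_nonneg (edgeWeight_nonneg G x z),
        abs_of_nonneg (damping_nonneg z y)]
      refine mul_le_mul (edgeWeight_le G x z) ?_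
        (mul_nonneg (damping_nonneg z y) (abs_nonneg _)) eps_pos.le
      calc _ ≤ 1 * m := mul_le_mul (damping_le_one hs z y) (h z hz) (abs_nonneg _) zero_le_one
        _ = m := one_mul m
  refine (Finset.abs_sum_le_sum_abs _ _).trans ((Finset.sum_le_sum this).trans ?_)
  simp [mul_assoc]

/-- The negative of the rescaled Lyapunov operator. -/
noncomputable def rescaledOp (G : Digraph V) (A : Set V) (s : ℝ) :
    Matrix V V ℝ →ₗ[ℝ] Matrix V V ℝ where
  toFun Z := Matrix.of fun x y =>
    (damping A s x y + damping A s y x) * Z x y - inflow G A s Z x y - inflow G A s Z y x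
  map_add' Z W := by
    ext x y
    simp only [inflow, Matrix.of_apply, Matrix.add_apply, mul_add, Finset.sum_add_distrib]
    ring
  map_smul' c Z := by
    ext x y
    simp only [inflow, Matrix.of_apply, Matrix.smul_apply, smul_eq_mul, RingHom.id_apply,
      mul_sub, Finset.mul_sum]
    congr 1
    · congr 1
      · ring
      · exact Finset.sum_congr rfl fun z _ => by ring
    · exact Finset.sum_congr rfl fun z _ => by ring

theorem rescaledOp_apply (G : Digraph V) (A : Set V) (s : ℝ) (Z : Matrix V V ℝ) (x y : V) :
    rescaledOp G A s Z x y = (damping A s x y + damping A s y x) * Z x y -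
      inflow G A s Z x y - inflow G A s Z y x := rfl

/-- Maximum principle, on a set of pairs that is closed under moving backwards along edges. -/
theorem abs_apply_le_of_rescaledOp {G : Digraph V} {A : Set V} {s : ℝ} (hs : s ^ 2 ≤ 1)
    {Z : Matrix V V ℝ} {P : V → V → Prop} {c : ℝ}
    (h₁ : ∀ x y z, P x y → G.Adj z x → P z y) (h₂ : ∀ x y z, P x y → G.Adj z y → P z x)
    (h : ∀ x y, P x y → |rescaledOp G A s Z x y| ≤ c) {x y : V} (hxy : P x y) :
    |Z x y| ≤ 2 * c := by
  have : Nonempty {p : V × V // P p.1 p.2} := ⟨⟨(x, y), hxy⟩⟩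
  -- At a pair in P maximizing |Z|, both inflows involve only pairs in P, so each is at most n·`eps`
  -- ≤ 1/16 times the maximum m, while the diagonal coefficient is at least 1. Thus m ≤ c + m/8.
  obtain ⟨⟨⟨u, v⟩, huv⟩, hmax⟩ :=
    Finite.exists_max fun p : {p : V × V // P p.1 p.2} => |Z p.1.1 p.1.2|
  simp only at hmax huv
  have hm := abs_nonneg (Z u v)
  have i1 : |inflow G A s Z u v| ≤ Fintype.card V * eps V * |Z u v| :=
    abs_inflow_le hs hm fun z hz =>
      hmax ⟨(z, v), h₁ u v z huv (adj_of_edgeWeight_ne_zero hz)⟩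
  have i2 : |inflow G A s Z v u| ≤ Fintype.card V * eps V * |Z u v| :=
    abs_inflow_le hs hm fun z hz =>
      hmax ⟨(z, u), h₂ u v z huv (adj_of_edgeWeight_ne_zero hz)⟩
  have hc := h u v huv
  rw [rescaledOp_apply] at hc
  have hbig : |Z u v| ≤ |(damping A s u v + damping A s v u) * Z u v| := by
    rw [abs_mul, abs_of_nonneg (zero_le_one.trans (one_le_damping_add u v))]
    exact le_mul_of_one_le_left hm (one_le_damping_add u v)
  have htri : |(damping A s u v + damping A s v u) * Z u v| ≤
      c + |inflow G A s Z u v| + |inflow G A s Z v u| := by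
    have e : (damping A s u v + damping A s v u) * Z u v =
        ((damping A s u v + damping A s v u) * Z u v - inflow G A s Z u v - inflow G A s Z v u) +
          inflow G A s Z u v + inflow G A s Z v u := by ring
    rw [e]
    refine (abs_add_le _ _).trans (add_le_add_left ((abs_add_le _ _).trans ?_) _)
    exact add_le_add_left hc _
  have := hmax ⟨(x, y), hxy⟩
  simp only at this
  nlinarith [card_mul_eps_le (V := V)]

theorem rescaledOp_injective (G : Digraph V) (A : Set V) {s : ℝ} (hs : s ^ 2 ≤ 1) :
    Function.Injective (rescaledOp G A s) := by
  rw [injective_iff_map_eq_zero]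
  intro Z hZ
  ext x y
  have := abs_apply_le_of_rescaledOp hs (Z := Z) (P := fun _ _ => True) (c := 0) (G := G) (A := A)
    (fun _ _ _ _ _ => trivial) (fun _ _ _ _ _ => trivial) (fun x y _ => by simp [hZ])
    (x := x) (y := y) trivial
  rw [mul_zero] at this
  exact abs_nonpos_iff.1 this

variable [DecidableEq V]

theorem exists_rescaledOp_eq (G : Digraph V) (A : Set V) {s : ℝ} (hs : s ^ 2 ≤ 1) :
    ∃ Z, rescaledOp G A s Z = (2 : ℝ) • (1 : Matrix V V ℝ) :=
  LinearMap.injective_iff_surjective.1 (rescaledOp_injective G A hs) _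

section solution

variable {G : Digraph V} {A : Set V} {s : ℝ} {Z : Matrix V V ℝ}

theorem damping_mul_solution (hZ : rescaledOp G A s Z = (2 : ℝ) • (1 : Matrix V V ℝ)) (x y : V) :
    (damping A s x y + damping A s y x) * Z x y =
      2 * (1 : Matrix V V ℝ) x y + inflow G A s Z x y + inflow G A s Z y x := by
  have := congrFun (congrFun hZ x) y
  rw [rescaledOp_apply, Matrix.smul_apply, smul_eq_mul] at this
  linarith

/-- The right-hand side of `damping_mul_solution` is symmetric in x and y, even before Z is known to
be. -/
theorem solution_symm (hZ : rescaledOp G A s Z = (2 : ℝ) • (1 : Matrix V V ℝ)) (x y : V) :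
    Z x y = Z y x := by
  have h1 := damping_mul_solution hZ x y
  have h2 := damping_mul_solution hZ y x
  have h3 : (1 : Matrix V V ℝ) x y = (1 : Matrix V V ℝ) y x := by
    simp [Matrix.one_apply, eq_comm]
  have h4 := one_le_damping_add (A := A) (s := s) x y
  refine mul_left_cancel₀ (show damping A s x y + damping A s y x ≠ 0 by linarith) ?_
  rw [h1, add_comm (damping A s x y), h2, h3]
  ring

theorem abs_solution_le (hs : s ^ 2 ≤ 1)
    (hZ : rescaledOp G A s Z = (2 : ℝ) • (1 : Matrix V V ℝ)) (x y : V) : |Z x y| ≤ 4 := by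
  have := abs_apply_le_of_rescaledOp hs (Z := Z) (P := fun _ _ => True) (c := 2) (G := G) (A := A)
    (fun _ _ _ _ _ => trivial) (fun _ _ _ _ _ => trivial) (fun x y _ => by
      rw [hZ, Matrix.smul_apply, Matrix.one_apply]; split_ifs <;> simp)
    (x := x) (y := y) trivial
  linarith

theorem abs_inflow_solution_le (hs : s ^ 2 ≤ 1)
    (hZ : rescaledOp G A s Z = (2 : ℝ) • (1 : Matrix V V ℝ)) (x y : V) :
    |inflow G A s Z x y| ≤ Fintype.card V * eps V * 4 :=
  abs_inflow_le hs (by norm_num) fun z _ => abs_solution_le hs hZ z y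

theorem abs_solution_offDiag_le (hs : s ^ 2 ≤ 1)
    (hZ : rescaledOp G A s Z = (2 : ℝ) • (1 : Matrix V V ℝ)) {x y : V} (hxy : x ≠ y) :
    |Z x y| ≤ 8 * (Fintype.card V * eps V) := by
  have h := damping_mul_solution hZ x y
  rw [Matrix.one_apply_ne hxy] at h
  have h1 := abs_inflow_solution_le hs hZ x y
  have h2 := abs_inflow_solution_le hs hZ y x
  have h3 : |Z x y| ≤ |(damping A s x y + damping A s y x) * Z x y| := by
    rw [abs_mul, abs_of_nonneg (zero_le_one.trans (one_le_damping_add x y))]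
    exact le_mul_of_one_le_left (abs_nonneg _) (one_le_damping_add x y)
  rw [h, mul_zero, zero_add] at h3
  linarith [abs_add_le (inflow G A s Z x y) (inflow G A s Z y x)]

theorem three_fourths_le_solution_diag (hs : s ^ 2 ≤ 1)
    (hZ : rescaledOp G A s Z = (2 : ℝ) • (1 : Matrix V V ℝ)) (x : V) :
    3 / 4 ≤ Z x x := by
  have h := damping_mul_solution hZ x x
  rw [damping_self, Matrix.one_apply_eq] at h
  have h1 := (abs_le.1 (abs_inflow_solution_le hs hZ x x)).1
  linarith [card_mul_eps_le (V := V)]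

/-- Minimum principle: at a negative minimum each inflow is at least 1/16 of that minimum, too
little to balance a diagonal coefficient of at least 1. -/
theorem solution_nonneg (hs : s ^ 2 ≤ 1)
    (hZ : rescaledOp G A s Z = (2 : ℝ) • (1 : Matrix V V ℝ)) (x y : V) : 0 ≤ Z x y := by
  have : Nonempty (V × V) := ⟨(x, y)⟩
  obtain ⟨⟨u, v⟩, hmin⟩ := Finite.exists_min fun p : V × V => Z p.1 p.2
  simp only [Prod.forall] at hmin
  refine le_trans ?_ (hmin x y)
  by_contra hneg
  rw [not_le] at hneg
  have hin : ∀ a b, Fintype.card V * eps V * Z u v ≤ inflow G A s Z a b := by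
    intro a b
    have : ∀ z ∈ Finset.univ, eps V * Z u v ≤ edgeWeight G a z * (damping A s z b * Z z b) := by
      intro z _
      have w0 := edgeWeight_nonneg G a z
      have d0 := damping_nonneg (A := A) (s := s) z b
      have wd : edgeWeight G a z * damping A s z b ≤ eps V * 1 :=
        mul_le_mul (edgeWeight_le G a z) (damping_le_one hs z b) d0 eps_pos.le
      calc eps V * Z u v ≤ edgeWeight G a z * damping A s z b * Z u v := by nlinarith
        _ ≤ edgeWeight G a z * damping A s z b * Z z b :=
          mul_le_mul_of_nonneg_left (hmin z b) (mul_nonneg w0 d0)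
        _ = _ := by ring
    have h := Finset.sum_le_sum this
    simpa [mul_assoc, inflow] using h
  have h := damping_mul_solution hZ u v
  have h0 : (0 : ℝ) ≤ (1 : Matrix V V ℝ) u v := by
    rw [Matrix.one_apply]; split_ifs <;> norm_num
  have h1 := one_le_damping_add (A := A) (s := s) u v
  nlinarith [hin u v, hin v u, card_mul_eps_le (V := V)]

/-- Pairs without a common ancestor are closed under passing to parents and avoid the diagonal,
where the source term lives. Unlike the vanishing result for the model, this covers s = 0. -/
theorem solution_eq_zero (hs : s ^ 2 ≤ 1)
    (hZ : rescaledOp G A s Z = (2 : ℝ) • (1 : Matrix V V ℝ)) {x y : V}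
    (hxy : ¬ (ancestors G x ∩ ancestors G y).Nonempty) : Z x y = 0 := by
  have := abs_apply_le_of_rescaledOp hs (Z := Z) (c := 0) (G := G) (A := A)
    (P := fun x y => ¬ (ancestors G x ∩ ancestors G y).Nonempty)
    (fun x y z h hz hne =>
      h (hne.mono (Set.inter_subset_inter_left _ (ancestors_subset_of_adj hz))))
    (fun x y z h hz hne =>
      h (Set.inter_comm _ _ ▸
        hne.mono (Set.inter_subset_inter_left _ (ancestors_subset_of_adj hz))))
    (fun x y h => by
      have hne : x ≠ y := by
        rintro rfl
        exact h ⟨x, self_mem_ancestors G x, self_mem_ancestors G x⟩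
      simp [hZ, hne])
    hxy
  rw [mul_zero] at this
  exact abs_nonpos_iff.1 this

/-- A leg that is not damped can be moved along an edge. -/
theorem solution_pos_of_adj (hs : s ^ 2 ≤ 1)
    (hZ : rescaledOp G A s Z = (2 : ℝ) • (1 : Matrix V V ℝ)) {x x' y : V}
    (h : 0 < Z x y) (hadj : G.Adj x x') (hA : x ∉ A ∨ y ∈ A) : 0 < Z x' y := by
  by_cases hne : x = x'
  · exact hne ▸ h
  have hw : edgeWeight G x' x = eps V := if_pos ⟨hadj, hne⟩
  have hnn : ∀ a b z, 0 ≤ edgeWeight G a z * (damping A s z b * Z z b) := fun a b z =>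
    mul_nonneg (edgeWeight_nonneg G a z)
      (mul_nonneg (damping_nonneg z b) (solution_nonneg hs hZ z b))
  have h1 : 0 < inflow G A s Z x' y :=
    Finset.sum_pos' (fun z _ => hnn x' y z) ⟨x, Finset.mem_univ x, by
      rw [hw, damping_eq_one hA, one_mul]; exact mul_pos eps_pos h⟩
  have h2 : 0 ≤ inflow G A s Z y x' := Finset.sum_nonneg fun z _ => hnn y x' z
  have h3 := damping_mul_solution hZ x' y
  have h4 : (0 : ℝ) ≤ (1 : Matrix V V ℝ) x' y := by
    rw [Matrix.one_apply]; split_ifs <;> norm_num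
  have h5 := one_le_damping_add (A := A) (s := s) x' y
  by_contra hle
  rw [not_lt] at hle
  nlinarith

theorem solution_pos_of_reach (hs : s ^ 2 ≤ 1)
    (hZ : rescaledOp G A s Z = (2 : ℝ) • (1 : Matrix V V ℝ)) {x v y : V} (hy : y ∈ A)
    (h : 0 < Z x y) (hxv : Relation.ReflTransGen G.Adj x v) : 0 < Z v y := by
  induction hxv with
  | refl => exact h
  | tail _ hadj ih => exact solution_pos_of_adj hs hZ ih hadj (.inr hy)

/-- A leg at a fast node is never damped, so it can be moved towards v until it first meets a slow
node. -/
theorem exists_solution_pos_mem (hs : s ^ 2 ≤ 1)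
    (hZ : rescaledOp G A s Z = (2 : ℝ) • (1 : Matrix V V ℝ)) {x y v : V}
    (hv : v ∈ A) (hyv : Relation.ReflTransGen G.Adj y v) (h : 0 < Z y x) :
    ∃ w ∈ A, Relation.ReflTransGen G.Adj w v ∧ 0 < Z w x := by
  induction hyv using Relation.ReflTransGen.head_induction_on with
  | refl => exact ⟨v, hv, .refl, h⟩
  | head hadj hr ih =>
    rename_i a c
    by_cases ha : a ∈ A
    · exact ⟨a, ha, .head hadj hr, h⟩
    · exact ih (solution_pos_of_adj hs hZ h hadj (.inl ha))

/-- The order of moves avoids damping, even at s = 0: from (a, a) one leg goes to the first slow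
node b on the way to v; with b slow the other leg goes freely to w; with w slow, b goes on to v. -/
theorem solution_pos_of_common_ancestor (hs : s ^ 2 ≤ 1)
    (hZ : rescaledOp G A s Z = (2 : ℝ) • (1 : Matrix V V ℝ)) {v w : V} (hv : v ∈ A)
    (hw : w ∈ A) (h : (ancestors G v ∩ ancestors G w).Nonempty) : 0 < Z v w := by
  obtain ⟨a, hav, haw⟩ := h
  have haa : 0 < Z a a := by linarith [three_fourths_le_solution_diag hs hZ a]
  obtain ⟨b, hb, hbv, hba⟩ := exists_solution_pos_mem hs hZ hv hav haa
  rw [solution_symm hZ] at hba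
  have h1 := solution_pos_of_reach hs hZ hb hba haw
  rw [solution_symm hZ] at h1
  exact solution_pos_of_reach hs hZ hw h1 hbv

theorem abs_solution_sub_le (hs : s ^ 2 ≤ 1)
    (hZ : rescaledOp G A s Z = (2 : ℝ) • (1 : Matrix V V ℝ)) {Z₀ : Matrix V V ℝ}
    (hZ₀ : rescaledOp G A 0 Z₀ = (2 : ℝ) • (1 : Matrix V V ℝ)) (x y : V) :
    |Z x y - Z₀ x y| ≤ 20 * s ^ 2 := by
  -- Since both equations have the same source, this compares the operators at 0 and s on Z: two
  -- damping terms of size 4s² and two inflow differences of at most s² each.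
  have key : ∀ x y, |rescaledOp G A 0 (Z - Z₀) x y| ≤ 10 * s ^ 2 := by
    intro x y
    rw [map_sub, hZ₀, ← hZ, Matrix.sub_apply, rescaledOp_apply, rescaledOp_apply]
    have hin : ∀ a b, |inflow G A 0 Z a b - inflow G A s Z a b| ≤ s ^ 2 := by
      intro a b
      have e : inflow G A 0 Z a b - inflow G A s Z a b =
          ∑ z, edgeWeight G a z * ((damping A 0 z b - damping A s z b) * Z z b) := by
        rw [inflow, inflow, ← Finset.sum_sub_distrib]
        exact Finset.sum_congr rfl fun z _ => by ring
      have : ∀ z ∈ Finset.univ,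
          |edgeWeight G a z * ((damping A 0 z b - damping A s z b) * Z z b)| ≤
            eps V * (s ^ 2 * 4) := by
        intro z _
        rw [abs_mul, abs_mul, abs_of_nonneg (edgeWeight_nonneg G a z)]
        exact mul_le_mul (edgeWeight_le G a z)
          (mul_le_mul (abs_damping_sub_le z b) (abs_solution_le hs hZ z b) (abs_nonneg _)
            (sq_nonneg s)) (by positivity) eps_pos.le
      rw [e]
      refine (Finset.abs_sum_le_sum_abs _ _).trans ((Finset.sum_le_sum this).trans ?_)
      rw [Finset.sum_const, Finset.card_univ, nsmul_eq_mul]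
      nlinarith [card_mul_eps_le (V := V), sq_nonneg s]
    have hd : ∀ a b, |(damping A 0 a b - damping A s a b) * Z x y| ≤ s ^ 2 * 4 := fun a b => by
      rw [abs_mul]
      exact mul_le_mul (abs_damping_sub_le a b) (abs_solution_le hs hZ x y) (abs_nonneg _)
        (sq_nonneg s)
    have h1 := abs_le.1 (hin x y)
    have h2 := abs_le.1 (hin y x)
    have h3 := abs_le.1 (hd x y)
    have h4 := abs_le.1 (hd y x)
    rw [abs_le]
    constructor <;> linarith [h1.1, h1.2, h2.1, h2.2, h3.1, h3.2, h4.1, h4.2]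
  have := abs_apply_le_of_rescaledOp (s := 0) (by norm_num) (Z := Z - Z₀) (P := fun _ _ => True)
    (G := G) (A := A) (fun _ _ _ _ _ => trivial) (fun _ _ _ _ _ => trivial) (fun x y _ => key x y)
    (x := x) (y := y) trivial
  rw [Matrix.sub_apply] at this
  linarith

end solution

end LyapunovModel

/-! ### Slow and fast nodes: model members, and the limit s → 0. -/

namespace LyapunovModel

open Matrix Filter Topology

variable {V : Type*} [Fintype V]

omit [Fintype V] in
open Classical in
/-- The scale of the coordinates: `1` on the slow nodes `A` and `s` on the fast ones. -/
noncomputable def coordScale (A : Set V) (s : ℝ) (x : V) : ℝ := if x ∈ A then 1 else s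

omit [Fintype V] in
open Classical in
/-- The covariance matrix after normalization of the fast coordinates by `coordScale`. -/
noncomputable def normalizedCov (A : Set V) (s : ℝ) (Z : Matrix V V ℝ) : Matrix V V ℝ :=
  Matrix.of fun x y => (if x ∈ A ↔ y ∈ A then 1 else s) * Z x y

/-- The covariance matrix with normalization `normalizedCov`. -/
noncomputable def scaledCov (A : Set V) (s : ℝ) (Z : Matrix V V ℝ) : Matrix V V ℝ :=
  Matrix.of fun x y => coordScale A s x * normalizedCov A s Z x y * coordScale A s y

/-- The drift matrix whose Lyapunov equation is solved by `scaledCov`. -/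
noncomputable def scaledDrift [DecidableEq V] (G : Digraph V) (A : Set V) (s : ℝ) :
    Matrix V V ℝ :=
  Matrix.of fun x z => (edgeWeight G x z - (1 : Matrix V V ℝ) x z) * (coordScale A s z ^ 2)⁻¹

section

variable {G : Digraph V} {A : Set V} {s : ℝ} {Z : Matrix V V ℝ}

omit [Fintype V] in
theorem coordScale_pos (hs : 0 < s) (x : V) : 0 < coordScale A s x := by
  unfold coordScale; split_ifs; exacts [one_pos, hs]

omit [Fintype V] in
-- This identity links the two pictures: the speeds s⁻² of the drift are absorbed into the
-- covariance, leaving coefficients that stay bounded as s → 0.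
theorem inv_sq_mul_scaledCov (hs : s ≠ 0) (x y : V) :
    (coordScale A s x ^ 2)⁻¹ * scaledCov A s Z x y = damping A s x y * Z x y := by
  by_cases hx : x ∈ A <;> by_cases hy : y ∈ A <;>
    simp [scaledCov, normalizedCov, coordScale, damping, hx, hy] <;> field_simp

omit [Fintype V] in
theorem normalizedCov_symm (hZ : ∀ x y, Z x y = Z y x) (x y : V) :
    normalizedCov A s Z x y = normalizedCov A s Z y x := by
  by_cases hx : x ∈ A <;> by_cases hy : y ∈ A <;> simp [normalizedCov, hx, hy, hZ x y]

omit [Fintype V] in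
theorem scaledCov_symm (hZ : ∀ x y, Z x y = Z y x) (x y : V) :
    scaledCov A s Z x y = scaledCov A s Z y x := by
  simp only [scaledCov, Matrix.of_apply, normalizedCov_symm hZ x y]
  ring

theorem scaledCov_mulVec (a : V → ℝ) (x : V) :
    (scaledCov A s Z *ᵥ a) x =
      coordScale A s x * (normalizedCov A s Z *ᵥ fun y => coordScale A s y * a y) x := by
  simp only [mulVec, dotProduct, scaledCov, Matrix.of_apply, Finset.mul_sum, mul_assoc]

variable [DecidableEq V]

theorem posDef_normalizedCov (hs₀ : 0 ≤ s) (hs₁ : s ≤ 1)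
    (hZ : rescaledOp G A s Z = (2 : ℝ) • (1 : Matrix V V ℝ)) : (normalizedCov A s Z).PosDef := by
  have hs : s ^ 2 ≤ 1 := pow_le_one₀ hs₀ hs₁
  refine posDef_of_offDiag_le (c := 3 / 4) (δ := 8 * (Fintype.card V * eps V))
    (normalizedCov_symm (solution_symm hZ)) (fun x => ?_) ?_ (fun x y hxy => ?_) ?_
  · simpa [normalizedCov] using three_fourths_le_solution_diag hs hZ x
  · have := eps_pos (V := V); positivity
  · refine le_trans ?_ (abs_solution_offDiag_le hs hZ hxy)
    rw [normalizedCov, Matrix.of_apply, abs_mul]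
    refine mul_le_of_le_one_left (abs_nonneg _) ?_
    split_ifs
    · simp
    · rwa [abs_of_nonneg hs₀]
  · linarith [card_mul_card_mul_eps_le (V := V)]

theorem posDef_scaledCov (hs₀ : 0 < s) (hs₁ : s ≤ 1)
    (hZ : rescaledOp G A s Z = (2 : ℝ) • (1 : Matrix V V ℝ)) : (scaledCov A s Z).PosDef := by
  refine Matrix.PosDef.of_dotProduct_mulVec_pos
    (by ext x y; simp [scaledCov_symm (solution_symm hZ) y x]) fun v hv => ?_
  have hv' : (fun y => coordScale A s y * v y) ≠ 0 := by
    obtain ⟨x, hx⟩ := Function.ne_iff.1 hv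
    exact Function.ne_iff.2 ⟨x, mul_ne_zero (coordScale_pos hs₀ x).ne' hx⟩
  have := (posDef_normalizedCov hs₀.le hs₁ hZ).dotProduct_mulVec_pos hv'
  convert this using 1
  simp only [dotProduct, scaledCov_mulVec, star_trivial]
  exact Finset.sum_congr rfl fun x _ => by ring

theorem scaledCov_mem_lyapunovModel (hG : ∀ i, G.Adj i i) (hs₀ : 0 < s) (hs₁ : s ≤ 1)
    (hZ : rescaledOp G A s Z = (2 : ℝ) • (1 : Matrix V V ℝ)) :
    scaledCov A s Z ∈ lyapunovModel G ((2 : ℝ) • (1 : Matrix V V ℝ)) := by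
  have hpd := posDef_scaledCov hs₀ hs₁ hZ
  have hsymm := solution_symm hZ
  have hMS : ∀ x y, (scaledDrift G A s * scaledCov A s Z) x y =
      inflow G A s Z x y - damping A s x y * Z x y := by
    intro x y
    have : ∀ z ∈ Finset.univ, scaledDrift G A s x z * scaledCov A s Z z y =
        edgeWeight G x z * (damping A s z y * Z z y) -
          (1 : Matrix V V ℝ) x z * (damping A s z y * Z z y) := by
      intro z _
      rw [scaledDrift, Matrix.of_apply, mul_assoc, inv_sq_mul_scaledCov hs₀.ne']
      ring
    rw [Matrix.mul_apply, Finset.sum_congr rfl this, Finset.sum_sub_distrib, inflow]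
    congr 1
    simp [Matrix.one_apply]
  have hL : scaledDrift G A s * scaledCov A s Z + scaledCov A s Z * (scaledDrift G A s)ᵀ +
      (2 : ℝ) • (1 : Matrix V V ℝ) = 0 := by
    have ht : (scaledCov A s Z)ᵀ = scaledCov A s Z := by
      ext x y; exact scaledCov_symm hsymm y x
    have ht' : scaledCov A s Z * (scaledDrift G A s)ᵀ =
        (scaledDrift G A s * scaledCov A s Z)ᵀ := by
      rw [transpose_mul, ht]
    rw [ht']
    ext x y
    have h := damping_mul_solution hZ x y
    simp only [Matrix.add_apply, transpose_apply, hMS, Matrix.smul_apply, smul_eq_mul,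
      Matrix.zero_apply, hsymm y x]
    linarith
  -- Stability comes from Lyapunov's criterion; the self-loops of G permit the diagonal of the
  -- drift.
  refine ⟨hpd, scaledDrift G A s, isStable_of_lyapunov hpd hL, fun i j hij => ?_, hL⟩
  have hne : j ≠ i := by
    rintro rfl
    exact hij (hG j)
  have hw : edgeWeight G j i = 0 := if_neg fun h => hij h.1
  simp [scaledDrift, hw, hne]

end

section singular

variable [DecidableEq V]

open Classical in
/-- The matrix whose kernel consists of the vectors `a` supported on `K ∪ {j}` such that `S a`
vanishes on `K ∪ {i}`. -/
noncomputable def residualMatrix (S : Matrix V V ℝ) (K : Set V) (i j : V) : Matrix V V ℝ :=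
  Matrix.of fun x => if x ∈ K then S x else if x = j then S i else (1 : Matrix V V ℝ) x

open Classical in
theorem residualMatrix_mulVec_eq_zero_iff {S : Matrix V V ℝ} {K : Set V} {i j : V} (hj : j ∉ K)
    (a : V → ℝ) : residualMatrix S K i j *ᵥ a = 0 ↔
      (∀ x, x ∉ K → x ≠ j → a x = 0) ∧ (∀ x ∈ K, (S *ᵥ a) x = 0) ∧ (S *ᵥ a) i = 0 := by
  have h : ∀ x, (residualMatrix S K i j *ᵥ a) x =
      if x ∈ K then (S *ᵥ a) x else if x = j then (S *ᵥ a) i else a x := by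
    intro x
    by_cases hx : x ∈ K
    · simp [residualMatrix, mulVec, hx]
    · by_cases hxj : x = j
      · subst hxj; simp [residualMatrix, mulVec, hx]
      · simp only [residualMatrix, mulVec, Matrix.of_apply, hx, hxj, if_false]
        exact congrFun (one_mulVec a) x
  constructor
  · intro h0
    have h' : ∀ x, (if x ∈ K then (S *ᵥ a) x else if x = j then (S *ᵥ a) i else a x) = 0 :=
      fun x => by rw [← h x, h0]; rfl
    refine ⟨fun x hx hxj => ?_, fun x hx => ?_, ?_⟩
    · simpa [hx, hxj] using h' x
    · simpa [hx] using h' x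
    · simpa [hj] using h' j
  · rintro ⟨h1, h2, h3⟩
    ext x
    rw [h x, Pi.zero_apply]
    split_ifs with hx hxj
    exacts [h2 x hx, h3, h1 x hx hxj]

theorem continuous_det_residualMatrix (K : Set V) (i j : V) :
    Continuous fun S : Matrix V V ℝ => (residualMatrix S K i j).det := by
  refine Continuous.matrix_det (continuous_pi fun x => continuous_pi fun y => ?_)
  by_cases hx : x ∈ K
  · simpa [residualMatrix, hx] using continuous_id.matrix_elem x y
  · by_cases hxj : x = j
    · subst hxj
      simpa [residualMatrix, hx] using continuous_id.matrix_elem i y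
    · simpa [residualMatrix, hx, hxj] using continuous_const

/-- Degenerate regressions survive in the limit. -/
theorem exists_residual_of_tendsto {S : ℝ → Matrix V V ℝ} {S₀ : Matrix V V ℝ} {l : Filter ℝ}
    [l.NeBot] (hS : Tendsto S l (𝓝 S₀)) {K : Set V} {i j : V} (hj : j ∉ K)
    (h : ∀ᶠ s in l, ∃ a : V → ℝ, a ≠ 0 ∧ (∀ x, x ∉ K → x ≠ j → a x = 0) ∧
      (∀ x ∈ K, (S s *ᵥ a) x = 0) ∧ (S s *ᵥ a) i = 0) :
    ∃ a : V → ℝ, a ≠ 0 ∧ (∀ x, x ∉ K → x ≠ j → a x = 0) ∧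
      (∀ x ∈ K, (S₀ *ᵥ a) x = 0) ∧ (S₀ *ᵥ a) i = 0 := by
  have h1 : Tendsto (fun s => (residualMatrix (S s) K i j).det) l
      (𝓝 (residualMatrix S₀ K i j).det) :=
    (continuous_det_residualMatrix K i j).continuousAt.tendsto.comp hS
  have h2 : (fun s => (residualMatrix (S s) K i j).det) =ᶠ[l] fun _ => 0 := by
    filter_upwards [h] with s ⟨a, ha, hk⟩
    exact Matrix.exists_mulVec_eq_zero_iff.1
      ⟨a, ha, (residualMatrix_mulVec_eq_zero_iff hj a).2 hk⟩
  have h3 : (residualMatrix S₀ K i j).det = 0 :=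
    tendsto_nhds_unique h1 (tendsto_const_nhds.congr' h2.symm)
  obtain ⟨a, ha, hk⟩ := Matrix.exists_mulVec_eq_zero_iff.2 h3
  exact ⟨a, ha, (residualMatrix_mulVec_eq_zero_iff hj a).1 hk⟩

end singular

variable [DecidableEq V]

/-- In the limit `s → 0`, a chordless path of slow nodes from `i` to `j` whose interior lies in
`K` excludes degenerate regressions. -/
theorem eq_zero_of_chordless_path {G : Digraph V} {A K : Set V} {Z : Matrix V V ℝ}
    (hZ : rescaledOp G A 0 Z = (2 : ℝ) • (1 : Matrix V V ℝ)) {k : ℕ} {v : ℕ → V}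
    (hA : ∀ x, x ∈ A ↔ ∃ l ≤ k, v l = x) (hK : ∀ l, 0 < l → l < k → v l ∈ K)
    (hinj : ∀ l m, l ≤ k → m ≤ k → v l = v m → l = m)
    (hadj : ∀ l < k, (ancestors G (v l) ∩ ancestors G (v (l + 1))).Nonempty)
    (hnadj : ∀ l m, l + 1 < m → m ≤ k →
      ¬ (ancestors G (v l) ∩ ancestors G (v m)).Nonempty) (hk : 0 < k) (hv0 : v 0 ∉ K)
    {a : V → ℝ} (ha : ∀ x, x ∉ K → x ≠ v k → a x = 0)
    (haK : ∀ x ∈ K, (normalizedCov A 0 Z *ᵥ a) x = 0)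
    (hai : (normalizedCov A 0 Z *ᵥ a) (v 0) = 0) : a = 0 := by
  have hs : (0 : ℝ) ^ 2 ≤ 1 := by norm_num
  have hmem : ∀ l ≤ k, v l ∈ A := fun l hl => (hA _).2 ⟨l, hl, rfl⟩
  -- At s = 0 the normalized covariance has no slow–fast entries, so the fast part b of a is
  -- annihilated on K and has zero quadratic form.
  have hfast : ∀ x, x ∉ A → a x = 0 := by
    classical
    set b : V → ℝ := fun x => if x ∈ A then 0 else a x with hb
    suffices b = 0 by
      intro x hx
      simpa [hb, hx] using congrFun this x
    by_contra hb0
    have hpos := (posDef_normalizedCov le_rfl zero_le_one hZ).dotProduct_mulVec_pos hb0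
    have hzero : ∀ x, b x * (normalizedCov A 0 Z *ᵥ b) x = 0 := by
      intro x
      by_cases hx : x ∈ A
      · simp [hb, hx]
      · by_cases hxK : x ∈ K
        · have : (normalizedCov A 0 Z *ᵥ b) x = (normalizedCov A 0 Z *ᵥ a) x := by
            refine Finset.sum_congr rfl fun y _ => ?_
            by_cases hy : y ∈ A <;> simp [normalizedCov, hb, hx, hy]
          rw [this, haK x hxK, mul_zero]
        · have hxj : x ≠ v k := fun h => hx (h ▸ hmem k le_rfl)
          simp [hb, hx, ha x hxK hxj]
    simp [dotProduct, hzero] at hpos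
  -- In row v l, earlier coordinates vanish by induction and entries beyond l + 1 by chordlessness,
  -- so a positive entry times a (v (l + 1)) is zero.
  have hslow : ∀ l ≤ k, a (v l) = 0 := by
    intro l
    induction l using Nat.strong_induction_on with
    | _ l ih =>
      intro hl
      rcases l with _ | l
      · exact ha _ hv0 fun h => hk.ne (hinj 0 k (Nat.zero_le _) le_rfl h)
      have hrow : (normalizedCov A 0 Z *ᵥ a) (v l) = 0 := by
        rcases Nat.eq_zero_or_pos l with h0 | h0
        · rw [h0]; exact hai
        · exact haK _ (hK l h0 hl)
      have hsum : (normalizedCov A 0 Z *ᵥ a) (v l) =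
          normalizedCov A 0 Z (v l) (v (l + 1)) * a (v (l + 1)) := by
        refine Finset.sum_eq_single (v (l + 1)) (fun y _ hy => ?_) fun h =>
          absurd (Finset.mem_univ _) h
        by_cases hyA : y ∈ A
        · obtain ⟨m, hm, rfl⟩ := (hA y).1 hyA
          rcases lt_trichotomy m (l + 1) with h | h | h
          · rw [ih m h hm, mul_zero]
          · exact absurd (h ▸ rfl) hy
          · have := solution_eq_zero hs hZ (hnadj l m h hm)
            simp [normalizedCov, this]
        · rw [hfast y hyA, mul_zero]
      have hpos := solution_pos_of_common_ancestor hs hZ (hmem l (by omega)) (hmem (l + 1) hl)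
        (hadj l hl)
      rw [hsum] at hrow
      have hne : normalizedCov A 0 Z (v l) (v (l + 1)) ≠ 0 := by
        simp [normalizedCov, hmem l (by omega), hmem (l + 1) hl, hpos.ne']
      exact (mul_eq_zero.1 hrow).resolve_left hne
  ext x
  by_cases hx : x ∈ A
  · obtain ⟨l, hl, rfl⟩ := (hA x).1 hx
    exact hslow l hl
  · exact hfast x hx

/-- Along a chordless path in the trek graph with interior in `K`, there is a member of the model
for which the end points are dependent given `K`. -/
theorem not_forall_gaussianCI_of_chordless_path {G : Digraph V} (hG : ∀ i, G.Adj i i)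
    {I J K : Set V} {k : ℕ} {v : ℕ → V} (hK : ∀ l, 0 < l → l < k → v l ∈ K)
    (hinj : ∀ l m, l ≤ k → m ≤ k → v l = v m → l = m)
    (hadj : ∀ l < k, (ancestors G (v l) ∩ ancestors G (v (l + 1))).Nonempty)
    (hnadj : ∀ l m, l + 1 < m → m ≤ k →
      ¬ (ancestors G (v l) ∩ ancestors G (v m)).Nonempty) (hk : 0 < k)
    (hI : v 0 ∈ I) (hJ : v k ∈ J) (hIK : v 0 ∉ K) (hJK : v k ∉ K) :
    ¬ ∀ S ∈ lyapunovModel G ((2 : ℝ) • (1 : Matrix V V ℝ)), GaussianCI S I J K := by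
  intro h
  set A : Set V := {x | ∃ l ≤ k, v l = x} with hA
  -- The solution is chosen for every real s, with junk value 0 when s² > 1; only s in [0, 1]
  -- matters.
  have hsol : ∀ s : ℝ, ∃ Z, s ^ 2 ≤ 1 →
      rescaledOp G A s Z = (2 : ℝ) • (1 : Matrix V V ℝ) := by
    intro s
    by_cases hs : s ^ 2 ≤ 1
    · obtain ⟨Z, hZ⟩ := exists_rescaledOp_eq G A hs
      exact ⟨Z, fun _ => hZ⟩
    · exact ⟨0, fun h' => absurd h' hs⟩
  choose Z hZ using hsol
  have hZ0 := hZ 0 (by norm_num)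
  have hIoc : ∀ᶠ s : ℝ in 𝓝[>] 0, 0 < s ∧ s ≤ 1 := by
    filter_upwards [Ioc_mem_nhdsGT (zero_lt_one (α := ℝ))] with s hs using hs
  have hid : Tendsto (fun s : ℝ => s) (𝓝[>] 0) (𝓝 0) :=
    tendsto_id.mono_left nhdsWithin_le_nhds
  have hZlim : ∀ x y, Tendsto (fun s => Z s x y) (𝓝[>] 0) (𝓝 (Z 0 x y)) := by
    intro x y
    rw [tendsto_iff_norm_sub_tendsto_zero]
    refine squeeze_zero' (Eventually.of_forall fun _ => norm_nonneg _)
      (g := fun s => 20 * s ^ 2) ?_ ?_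
    · filter_upwards [hIoc] with s hs
      have hs2 : s ^ 2 ≤ 1 := pow_le_one₀ hs.1.le hs.2
      exact abs_solution_sub_le hs2 (hZ s hs2) hZ0 x y
    · simpa using (hid.pow 2).const_mul 20
  have hlim : Tendsto (β := V → V → ℝ) (fun s => normalizedCov A s (Z s)) (𝓝[>] 0)
      (𝓝 (normalizedCov A 0 (Z 0))) := by
    refine tendsto_pi_nhds.2 fun x => tendsto_pi_nhds.2 fun y => ?_
    by_cases hxy : x ∈ A ↔ y ∈ A
    · simpa only [normalizedCov, Matrix.of_apply, hxy, if_true, one_mul] using hZlim x y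
    · simpa only [normalizedCov, Matrix.of_apply, hxy, if_false] using hid.mul (hZlim x y)
  obtain ⟨a, ha, ha1, ha2, ha3⟩ := exists_residual_of_tendsto hlim (i := v 0) hJK (by
    filter_upwards [hIoc] with s hs
    have hs2 : s ^ 2 ≤ 1 := pow_le_one₀ hs.1.le hs.2
    obtain ⟨a, ha0, ha1, ha2, ha3⟩ := GaussianCI.exists_residual
      (posDef_scaledCov hs.1 hs.2 (hZ s hs2))
      (h _ (scaledCov_mem_lyapunovModel hG hs.1 hs.2 (hZ s hs2))) hI hJ hJK
    have hne : ∀ x, coordScale A s x ≠ 0 := fun x => (coordScale_pos hs.1 x).ne'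
    -- The covariance is DND with D the diagonal of scales, so a degenerate vector a for it yields
    -- Da for N.
    refine ⟨fun y => coordScale A s y * a y, ?_, fun x hx hxj => ?_, fun x hx => ?_, ?_⟩
    · exact Function.ne_iff.2 ⟨v k, mul_ne_zero (hne _) (by rw [ha0]; exact one_ne_zero)⟩
    · simp only [ha1 x hx hxj, mul_zero]
    · have := ha2 x hx
      rw [scaledCov_mulVec] at this
      exact (mul_eq_zero.1 this).resolve_left (hne x)
    · rw [scaledCov_mulVec] at ha3
      exact (mul_eq_zero.1 ha3).resolve_left (hne _))
  exact ha (eq_zero_of_chordless_path hZ0 (fun x => Iff.rfl) hK hinj hadj hnadj hk hIK ha1 ha2 ha3)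

end LyapunovModel

/-! ### Chordless paths in the trek graph and the two implications. -/

namespace LyapunovModel

open Matrix

variable {V : Type*}

/-- A shortest sequence of successively related nodes of `I ∪ J ∪ K` from `I` to `J` has its
interior in `K` and is chordless. -/
theorem exists_chordless_path {I J K : Set V} {R : V → V → Prop} {v : ℕ → V} {k : ℕ}
    (h0 : v 0 ∈ I) (hk : v k ∈ J) (hU : ∀ l ≤ k, v l ∈ I ∪ J ∪ K)
    (hR : ∀ l < k, R (v l) (v (l + 1))) :
    ∃ (v : ℕ → V) (k : ℕ), v 0 ∈ I ∧ v k ∈ J ∧ (∀ l, 0 < l → l < k → v l ∈ K) ∧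
      (∀ l < k, R (v l) (v (l + 1))) ∧ (∀ l m, l ≤ k → m ≤ k → v l = v m → l = m) ∧
      ∀ l m, l + 1 < m → m ≤ k → ¬ R (v l) (v m) := by
  classical
  let Q : ℕ → Prop := fun k => ∃ v : ℕ → V, v 0 ∈ I ∧ v k ∈ J ∧ (∀ l ≤ k, v l ∈ I ∪ J ∪ K) ∧
    ∀ l < k, R (v l) (v (l + 1))
  have hQ : ∃ k, Q k := ⟨k, v, h0, hk, hU, hR⟩
  clear h0 hk hU hR v k
  obtain ⟨v, h0, hk, hU, hR⟩ := Nat.find_spec hQ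
  set k := Nat.find hQ with hkdef
  have hmin : ∀ m < k, ¬ Q m := fun m hm => Nat.find_min hQ hm
  -- shortcut: jump from position `l` to position `l + 1 + d`
  have hshort : ∀ l d, 0 < d → l + 1 + d ≤ k → ¬ R (v l) (v (l + 1 + d)) := by
    intro l d hd hle hr
    refine hmin (k - d) (by omega) ⟨fun n => if n ≤ l then v n else v (n + d), by simpa, ?_,
      fun n hn => ?_, fun n hn => ?_⟩
    · have h1 : ¬ k - d ≤ l := by omega
      have h2 : k - d + d = k := by omega
      simpa only [h1, if_false, h2] using hk
    · by_cases h : n ≤ l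
      · simpa only [h, if_true] using hU n (by omega)
      · simpa only [h, if_false] using hU (n + d) (by omega)
    · rcases lt_trichotomy n l with h | h | h
      · simpa only [h.le, Nat.succ_le_of_lt h, if_true] using hR n (by omega)
      · subst h
        have h1 : ¬ n + 1 ≤ n := by omega
        simpa only [le_refl, h1, if_true, if_false] using hr
      · have h1 : ¬ n ≤ l := by omega
        have h2 : ¬ n + 1 ≤ l := by omega
        have h3 : n + 1 + d = n + d + 1 := by omega
        simpa only [h1, h2, if_false, h3] using hR (n + d) (by omega)
  -- A repeated node either allows truncation, when its second occurrence is the end, or gives a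
  -- shortcut to the successor of that occurrence.
  have hne : ∀ l d, 0 < d → l + d ≤ k → v l ≠ v (l + d) := by
    intro l d hd hle he
    rcases Nat.eq_or_lt_of_le hle with h | h
    · exact hmin l (by omega) ⟨v, h0, by rw [he, h]; exact hk, fun n hn => hU n (by omega),
        fun n hn => hR n (by omega)⟩
    · have h3 : l + 1 + d = l + d + 1 := by omega
      exact hshort l d hd (by omega) (by rw [h3, he]; exact hR (l + d) h)
  refine ⟨v, k, h0, hk, fun l hl0 hlk => ?_, hR, fun l m hl hm he => ?_, fun l m hlm hm => ?_⟩
  -- An interior node in I could serve as a later start, one in J as an earlier end; both contradict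
  -- minimality.
  · rcases hU l hlk.le with (h | h) | h
    · refine absurd ⟨fun n => v (n + l), by simpa using h, ?_, fun n hn => hU _ (by omega),
        fun n hn => ?_⟩ (hmin (k - l) (by omega))
      · have : k - l + l = k := by omega
        simpa only [this] using hk
      · have : n + 1 + l = n + l + 1 := by omega
        simpa only [this] using hR (n + l) (by omega)
    · exact absurd ⟨v, h0, h, fun n hn => hU n (by omega), fun n hn => hR n (by omega)⟩
        (hmin l hlk)
    · exact h
  · rcases lt_trichotomy l m with h | h | h
    · obtain ⟨d, rfl⟩ := Nat.exists_eq_add_of_le h.le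
      exact absurd he (hne l d (by omega) hm)
    · exact h
    · obtain ⟨d, rfl⟩ := Nat.exists_eq_add_of_le h.le
      exact absurd he.symm (hne m d (by omega) hl)
  · obtain ⟨d, rfl⟩ := Nat.exists_eq_add_of_le hlm.le
    exact hshort l d (by omega) hm

variable [Fintype V] [DecidableEq V]

theorem gaussianCI_of_separates {G : Digraph V} {I J K : Set V}
    (h : Separates (trekGraph G) (I ∪ J ∪ K)ᶜ I J) {S : Matrix V V ℝ}
    (hS : S ∈ lyapunovModel G ((2 : ℝ) • (1 : Matrix V V ℝ))) : GaussianCI S I J K := by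
  set U := I ∪ J ∪ K with hU
  set A : Set V := {x | ∃ i ∈ I, ∃ p : (trekGraph G).Walk i x, ∀ v ∈ p.support, v ∈ U} with hA
  -- A is what I reaches inside U. Separation serves only to keep J out of A; a nonzero covariance
  -- between A and U \ A would be an edge enlarging A.
  refine gaussianCI_of_block_zero hS.1.posSemidef (A := A) (B := U \ A) (fun i hi => ?_)
    (fun j hj => ⟨.inl (.inr hj), ?_⟩) (fun x hx => ?_) fun a ha b hb => ?_
  · refine ⟨i, hi, .nil, fun v hv => ?_⟩
    rw [SimpleGraph.Walk.support_nil, List.mem_singleton] at hv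
    exact hv ▸ .inl (.inl hi)
  · rintro ⟨i, hi, p, hp⟩
    obtain ⟨v, hv, hvU⟩ := h i hi j hj p.toPath p.toPath.2
    exact hvU (hp v (p.support_toPath_subset_support hv))
  · by_cases hxA : x ∈ A
    · exact .inl hxA
    · exact .inr ⟨.inr hx, hxA⟩
  · refine apply_eq_zero_of_mem_lyapunovModel hS fun hne => hb.2 ?_
    obtain ⟨i, hi, p, hp⟩ := ha
    have hab : (trekGraph G).Adj a b := by
      refine ⟨?_, hne⟩
      rintro rfl
      exact hb.2 ⟨i, hi, p, hp⟩
    refine ⟨i, hi, p.concat hab, fun v hv => ?_⟩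
    rw [SimpleGraph.Walk.support_concat, List.mem_append, List.mem_singleton] at hv
    rcases hv with hv | rfl
    · exact hp v hv
    · exact hb.1

theorem separates_of_forall_gaussianCI {G : Digraph V} (hG : ∀ i, G.Adj i i) {I J K : Set V}
    (hIJ : Disjoint I J) (hIK : Disjoint I K) (hJK : Disjoint J K)
    (h : ∀ S ∈ lyapunovModel G ((2 : ℝ) • (1 : Matrix V V ℝ)), GaussianCI S I J K) :
    Separates (trekGraph G) (I ∪ J ∪ K)ᶜ I J := by
  intro i hi j hj p _
  by_contra hp
  push Not at hp
  obtain ⟨v, k, h0, hk, hK, hR, hinj, hnR⟩ := exists_chordless_path (K := K)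
    (R := (trekGraph G).Adj) (v := p.getVert) (k := p.length) (I := I) (J := J)
    (by simpa using hi) (by simpa using hj)
    (fun l _ => not_not.1 (hp _ (p.getVert_mem_support l))) fun l hl => p.adj_getVert_succ hl
  have hk0 : 0 < k := by
    rcases Nat.eq_zero_or_pos k with h' | h'
    · exact absurd (h' ▸ hk) (Set.disjoint_left.1 hIJ h0)
    · exact h'
  refine not_forall_gaussianCI_of_chordless_path hG hK hinj (fun l hl => (hR l hl).2)
    (fun l m hlm hm hne => hnR l m hlm hm ⟨fun he => ?_, hne⟩) hk0 h0 hk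
    (Set.disjoint_left.1 hIK h0) (Set.disjoint_left.1 hJK hk) h
  have := hinj l m (by omega) hm he
  omega

theorem isMarkovPerfect_lyapunovModel (G : Digraph V) (hG : ∀ i, G.Adj i i) :
    IsMarkovPerfect (lyapunovModel G ((2 : ℝ) • (1 : Matrix V V ℝ))) (trekGraph G) :=
  fun _ _ _ hIJ hIK hJK => ⟨separates_of_forall_gaussianCI hG hIJ hIK hJK,
    fun h _ hS => gaussianCI_of_separates h hS⟩

end LyapunovModel

theorem theorem4p1 {V : Type*} [Fintype V] [DecidableEq V] (G : Digraph V)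
    (hG : ∀ i, G.Adj i i) :
    LyapunovModel.IsMarkovPerfect
      (LyapunovModel.lyapunovModel G ((2 : ℝ) • (1 : Matrix V V ℝ)))
      (LyapunovModel.trekGraph G) ∧
    ∀ (i j : V) (K : Set V), i ≠ j → i ∉ K → j ∉ K →
      ((∀ S ∈ LyapunovModel.lyapunovModel G ((2 : ℝ) • (1 : Matrix V V ℝ)),
          LyapunovModel.GaussianCI S {i} {j} K) ↔
        LyapunovModel.Separates (LyapunovModel.trekGraph G) ({i, j} ∪ K)ᶜ {i} {j}) := by
  have h := LyapunovModel.isMarkovPerfect_lyapunovModel G hG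
  refine ⟨h, fun i j K hij hi hj => ?_⟩
  rw [Set.insert_eq]
  exact h {i} {j} K (Set.disjoint_singleton.2 hij) (Set.disjoint_singleton_left.2 hi)
    (Set.disjoint_singleton_left.2 hj)
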